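/- Setting. Let $M\subset\mathbb R^3$ be compact with smooth boundary $\partial M$ and outward unit normal $n$, let $c\in C(M;\mathbb R)$, $g_0'\in C(M;\mathbb R^3)$, $\rho_0\in C^1(M;\mathbb R)$ with $c^2>0$ and $\rho_0>0$ on $M$, and let $\Omega\in\mathbb R^3$, $G>0$. Assume that $g_0'$ and $\nabla\rho_0$ are parallel (linearly dependent) at every point of $M$, that $g_0'$ and $n$ are parallel on $\partial M$, and that $g_0'\cdot n<0$ on $\partial M$. Put $\kappa=c^2\rho_0$ and $H=L^2(M,\rho_0\,dx)^3$ (complex vector fields; inner products are conjugate-linear in the first argument). For $w\in L^2(\mathbb R^3)^3$ let $S(w)$ be the finite-energy weak solution of $\nabla^2 S(w)=-4\pi G\,\nabla\cdot w$ in $\mathbb R^3$: $\nabla S(w)$ lies in the $L^2$-closure of the gradients of test functions; $\rho_0u$ is extended by zero outside $M$. Let $H_{\mathrm{Div}}(M,L^2(\partial M))$ be the closure of $C^\infty(M)^3$ under the norm with square $\int_M(|\nabla\cdot u|^2+|u|^2)\rho_0\,dx+\int_{\partial M}|n\cdot u|^2\,ds$, and on it let $$a_2(v,u)=\int_M \kappa(\nabla\cdot\bar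 v)(\nabla\cdot u)+\rho_0(\nabla\cdot\bar v)(g_0'\cdot u)+(g_0'\cdot\bar v)(\nabla\cdot(\rho_0u))\,dx-\frac1{4\pi G}\int_{\mathbb R^3}\nabla S(\rho_0\bar v)\cdot\nabla S(\rho_0u)\,dx-\int_{\partial M}(n\cdot\bar v)\,\rho_0\,(g_0'\cdot u)\,ds .$$ Let $A_2$ be the operator in $H$ associated with $a_2$: its domain $D(A_2)$ consists of the $u\in H_{\mathrm{Div}}(M,L^2(\partial M))$ for which $v\mapsto a_2(v,u)$ is continuous in the norm of $H$, and $\langle v,A_2u\rangle_H=a_2(v,u)$ for all $v\in H_{\mathrm{Div}}(M,L^2(\partial M))$. Let $R_\Omega u=\Omega\times u$ and let $L(\lambda)=\lambda^2\,\mathrm{Id}+2\lambda R_\Omega+A_2$, $\lambda\in\mathbb C$, with domain $D(A_2)$. The spectrum $\sigma(L)$ is the set of $\lambda\in\mathbb C$ for which $L(\lambda)$ is not a bijection of $D(A_2)$ onto $H$ with bounded inverse. Proposition (Dyson–Schutz). 1. $\sigma(L)\subseteq i\mathbb R\cup\{\lambda\in\mathbb C:\ |\operatorname{Im}\lambda|\le|\Omega|\}$.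 2. $A_2$ is bounded below, and for every lower bound $\gamma\in\mathbb R$ of $A_2$ (that is, $\langle u,A_2u\rangle_H\ge\gamma\|u\|_H^2$ for all $u\in D(A_2)$), in particular for the greatest lower bound $\gamma(A_2)$, every $\lambda\in\sigma(L)$ with $\lambda\notin i\mathbb R$ satisfies $|\lambda|^2\le\max(0,-\gamma)$. -/

import Mathlib

open MeasureTheory
open scoped MeasureTheory ContDiff ComplexConjugate Topology ENNReal

noncomputable section

/-! ### Quadratic operator pencils and their spectra -/

/-- The resolvent set of a family `T(z)`, `z ∈ ℂ`, of (possibly unbounded) linear operators in `H`: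
the set of `z` for which `T(z)`, defined on its domain, is a bijection onto `H` with bounded
inverse. -/
def pencilResolventSet {H : Type*} [NormedAddCommGroup H] [NormedSpace ℂ H]
    (T : ℂ → (H →ₗ.[ℂ] H)) : Set ℂ :=
  {z | Function.Bijective (fun u : (T z).domain => T z u) ∧
    ∃ C : ℝ, ∀ u : (T z).domain, ‖(u : H)‖ ≤ C * ‖T z u‖}

/-- The spectrum of an operator pencil: the complement of the resolvent set. -/
def pencilSpectrum {H : Type*} [NormedAddCommGroup H] [NormedSpace ℂ H]
    (T : ℂ → (H →ₗ.[ℂ] H)) : Set ℂ :=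
  (pencilResolventSet T)ᶜ

/-- `γ` is a lower bound of the (symmetric) operator `A`: `γ ‖u‖² ≤ ⟨u, A u⟩` on the domain. -/
def IsOperatorLowerBound {H : Type*} [NormedAddCommGroup H] [InnerProductSpace ℂ H]
    (A : H →ₗ.[ℂ] H) (γ : ℝ) : Prop :=
  ∀ u : A.domain, γ * ‖(u : H)‖ ^ 2 ≤ (inner ℂ (u : H) (A u)).re

/-! ### Vectors, vector calculus -/

/-- Physical space `ℝ³`. -/
abbrev E3 : Type := EuclideanSpace ℝ (Fin 3)

/-- The space `ℂ³` of complex displacement vectors. -/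
abbrev C3 : Type := EuclideanSpace ℂ (Fin 3)

/-- The bilinear product `a · z` of a real vector and a complex vector. -/
def dotRC (a : E3) (z : C3) : ℂ := ∑ i, (a i : ℂ) * z i

/-- The linear map `z ↦ a × z` on `ℂ³`, for a real vector `a`. -/
def crossRC (a : E3) : C3 →L[ℂ] C3 :=
  LinearMap.toContinuousLinearMap
    ((WithLp.linearEquiv 2 ℂ (Fin 3 → ℂ)).symm.toLinearMap ∘ₗ
      crossProduct (fun i => (a i : ℂ)) ∘ₗ (WithLp.linearEquiv 2 ℂ (Fin 3 → ℂ)).toLinearMap)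

/-- The divergence of a complex vector field on `ℝ³`. -/
def div3 (U : E3 → C3) (x : E3) : ℂ :=
  ∑ i, (fderiv ℝ U x (EuclideanSpace.single i 1)) i

/-- The gradient of a complex valued function on `ℝ³`. -/
def grad3 (ψ : E3 → ℂ) (x : E3) : C3 :=
  WithLp.toLp 2 fun i => fderiv ℝ ψ x (EuclideanSpace.single i 1)

theorem dotRC_add (a : E3) (y z : C3) : dotRC a (y + z) = dotRC a y + dotRC a z := by
  simp [dotRC, mul_add, Finset.sum_add_distrib]

theorem dotRC_smul (a : E3) (k : ℂ) (z : C3) : dotRC a (k • z) = k * dotRC a z := by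
  simp only [dotRC, PiLp.smul_apply, smul_eq_mul, Finset.mul_sum]
  exact Finset.sum_congr rfl fun i _ => by ring

theorem norm_dotRC_le (a : E3) (z : C3) : ‖dotRC a z‖ ≤ 3 * ‖a‖ * ‖z‖ := by
  refine (norm_sum_le _ _).trans ?_
  have : ∀ i ∈ Finset.univ, ‖(a i : ℂ) * z i‖ ≤ ‖a‖ * ‖z‖ := fun i _ => by
    rw [norm_mul, Complex.norm_real]
    exact mul_le_mul (PiLp.norm_apply_le a i) (PiLp.norm_apply_le z i) (norm_nonneg _)
      (norm_nonneg _)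
  refine (Finset.sum_le_sum this).trans ?_
  simp; linarith

theorem div3_add {U V : E3 → C3} (hU : ContDiff ℝ ∞ U) (hV : ContDiff ℝ ∞ V) (x : E3) :
    div3 (U + V) x = div3 U x + div3 V x := by
  simp only [div3]
  rw [fderiv_add (hU.differentiable (by simp) x) (hV.differentiable (by simp) x)]
  simp [Finset.sum_add_distrib]

theorem div3_smul {U : E3 → C3} (hU : ContDiff ℝ ∞ U) (k : ℂ) (x : E3) :
    div3 (k • U) x = k * div3 U x := by
  simp only [div3]
  rw [fderiv_const_smul (hU.differentiable (by simp) x)]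
  simp [Finset.mul_sum]

/-! ### The perturbation of the gravitational field -/

/-- The gradients of complex test functions, as a subspace of `L²(ℝ³)³`. -/
def testGradients : Submodule ℂ (Lp C3 2 (volume : Measure E3)) where
  carrier := {F | ∃ ψ : E3 → ℂ, ContDiff ℝ ∞ ψ ∧ HasCompactSupport ψ ∧ F =ᵐ[volume] grad3 ψ}
  zero_mem' := by
    refine ⟨0, contDiff_const, HasCompactSupport.zero, ?_⟩
    filter_upwards [Lp.coeFn_zero C3 2 (volume : Measure E3)] with x hx
    rw [hx]; ext i; simp [grad3]
  add_mem' := by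
    rintro F F' ⟨ψ, h1, h2, h3⟩ ⟨ψ', h1', h2', h3'⟩
    refine ⟨ψ + ψ', h1.add h1', h2.add h2', ?_⟩
    filter_upwards [Lp.coeFn_add F F', h3, h3'] with x hx h h'
    rw [hx, Pi.add_apply, h, h']
    ext i
    simp [grad3, fderiv_add (h1.differentiable (by simp) x) (h1'.differentiable (by simp) x)]
  smul_mem' := by
    rintro k F ⟨ψ, h1, h2, h3⟩
    refine ⟨k • ψ, contDiff_const.smul h1, h2.smul_left (f := fun _ => k), ?_⟩
    filter_upwards [Lp.coeFn_smul k F, h3] with x hx h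
    rw [hx, Pi.smul_apply, h]
    ext i
    simp [grad3, fderiv_const_smul (h1.differentiable (by simp) x)]

/-- The operator `w ↦ ∇S(w)` on `L²(ℝ³)³`, where `Φ = S(w)` solves the Poisson equation
`∇²Φ = -4πG ∇·w` in `ℝ³`. The potential is the finite energy weak solution: `∇Φ` lies in the
`L²`-closure of the gradients of test functions and `∫ ∇ψ̄ · ∇Φ = -4πG ∫ ∇ψ̄ · w` for every test
function `ψ`. Hence `∇S(w)` is `-4πG` times the orthogonal projection of `w` onto this closure;
see `gravityGradient_eq_iff`. -/
def gravityGradient (G : ℝ) :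
    Lp C3 2 (volume : Measure E3) →L[ℂ] Lp C3 2 (volume : Measure E3) :=
  ((-(4 * Real.pi * G) : ℝ) : ℂ) • testGradients.topologicalClosure.starProjection

/-- `gravityGradient G w` is the gradient of the weak solution of `∇²Φ = -4πG ∇·w`. -/
theorem gravityGradient_eq_iff (G : ℝ) (w F : Lp C3 2 (volume : Measure E3)) :
    gravityGradient G w = F ↔
      F ∈ testGradients.topologicalClosure ∧
        ∀ E ∈ testGradients, inner ℂ E F = ((-(4 * Real.pi * G) : ℝ) : ℂ) * inner ℂ E w := by
  set k : ℂ := ((-(4 * Real.pi * G) : ℝ) : ℂ) with hk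
  have key : ∀ E ∈ testGradients.topologicalClosure,
      inner ℂ E (gravityGradient G w) = k * inner ℂ E w := by
    intro E hE
    rw [gravityGradient, smul_apply, inner_smul_right,
      ← Submodule.inner_starProjection_left_eq_right,
      Submodule.starProjection_eq_self_iff.mpr hE]
  constructor
  · rintro rfl
    refine ⟨?_, fun E hE => key E (Submodule.le_topologicalClosure _ hE)⟩
    exact Submodule.smul_mem _ _ (Submodule.starProjection_apply_mem _ _)
  · rintro ⟨hF, h⟩
    have hG : gravityGradient G w ∈ testGradients.topologicalClosure :=
      Submodule.smul_mem _ _ (Submodule.starProjection_apply_mem _ _)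
    have hd := Submodule.sub_mem _ hG hF
    have horth : ∀ E ∈ testGradients.topologicalClosure,
        inner ℂ E (gravityGradient G w - F) = 0 := by
      intro E hE
      have hcl : IsClosed {E : Lp C3 2 (volume : Measure E3) |
          inner ℂ E (gravityGradient G w - F) = 0} :=
        isClosed_eq (by fun_prop) continuous_const
      have hsub : (testGradients : Set (Lp C3 2 (volume : Measure E3))) ⊆
          {E | inner ℂ E (gravityGradient G w - F) = 0} := fun E hE => by
        simp only [Set.mem_ofPred_eq]
        rw [inner_sub_right, key E (Submodule.le_topologicalClosure _ hE), h E hE, sub_self]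
      exact closure_minimal hsub hcl hE
    exact sub_eq_zero.mp (inner_self_eq_zero.mp (horth _ hd))

/-! ### Domains with smooth boundary -/

/-- Near its boundary point `p`, the set `M` is the sublevel set `{r ≤ 0}` of a smooth function `r`
whose gradient at `p` is a positive multiple of the unit vector `ν`; that is, `∂M` is smooth near
`p`, with `M` on one side of it, and `ν` is the outward unit normal at `p`. -/
def IsOutwardNormal (M : Set E3) (p ν : E3) : Prop :=
  ‖ν‖ = 1 ∧ ∃ r : E3 → ℝ, ContDiff ℝ ∞ r ∧ (∀ᶠ x in 𝓝 p, x ∈ M ↔ r x ≤ 0) ∧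
    ∃ s : ℝ, 0 < s ∧ gradient r p = s • ν

/-- A compact subset of `ℝ³` with smooth boundary. -/
def IsCompactSmoothDomain (M : Set E3) : Prop :=
  IsCompact M ∧ ∀ p ∈ frontier M, ∃ ν : E3, IsOutwardNormal M p ν

/-- The outward unit normal. -/
def outwardNormal (M : Set E3) (p : E3) : E3 := Classical.epsilon (IsOutwardNormal M p)

theorem outwardNormal_spec {M : Set E3} (hM : IsCompactSmoothDomain M) {p : E3}
    (hp : p ∈ frontier M) : IsOutwardNormal M p (outwardNormal M p) :=
  Classical.epsilon_spec (hM.2 p hp)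

/-- Along a direction `v` the defining function changes to first order by `⟨ν, v⟩`. -/
theorem slope_of_gradient {r : E3 → ℝ} (hr : ContDiff ℝ ∞ r) {p ν : E3} {s : ℝ}
    (hgrad : gradient r p = s • ν) (v : E3) :
    Filter.Tendsto (fun t : ℝ => t⁻¹ * (r (p + t • v) - r p)) (𝓝[>] 0) (𝓝 (s * inner ℝ ν v)) := by
  have hline : HasDerivAt (fun t : ℝ => p + t • v) v 0 := by
    simpa using ((hasDerivAt_id (0 : ℝ)).smul_const v).const_add p
  have hder : HasDerivAt (fun t : ℝ => r (p + t • v)) (s * inner ℝ ν v) 0 := by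
    have h1 : HasFDerivAt r (fderiv ℝ r p) (p + (0 : ℝ) • v) := by
      simpa using (hr.differentiable (by simp) p).hasFDerivAt
    have h2 := h1.comp_hasDerivAt (0 : ℝ) hline
    have h3 : fderiv ℝ r p v = s * inner ℝ ν v := by
      have : inner ℝ (gradient r p) v = fderiv ℝ r p v := by simp [gradient]
      rw [← this, hgrad, real_inner_smul_left]
    rw [← h3]; exact h2
  simpa using hder.tendsto_slope_zero_right

theorem tendsto_line (p v : E3) : Filter.Tendsto (fun t : ℝ => p + t • v) (𝓝[>] 0) (𝓝 p) := by
  have h : Continuous fun t : ℝ => p + t • v := by fun_prop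
  have := h.tendsto 0
  simp only [zero_smul, add_zero] at this
  exact this.mono_left nhdsWithin_le_nhds

/-- From a boundary point one enters `M` along every direction making an obtuse angle with a
normal. -/
theorem IsOutwardNormal.enters {M : Set E3} (hM : IsClosed M) {p ν : E3}
    (hp : p ∈ frontier M) (h : IsOutwardNormal M p ν) {v : E3} (hv : inner ℝ ν v < 0) :
    ∀ᶠ t : ℝ in 𝓝[>] 0, p + t • v ∈ M := by
  obtain ⟨-, r, hr, hloc, s, hs, hgrad⟩ := h
  have hrp : r p ≤ 0 := (hloc.self_of_nhds).1 (hM.frontier_subset hp)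
  filter_upwards [(slope_of_gradient hr hgrad v).eventually_lt_const
    (mul_neg_of_pos_of_neg hs hv), (tendsto_line p v).eventually hloc,
    self_mem_nhdsWithin] with t h1 h2 ht
  refine h2.2 ?_
  have := neg_of_mul_neg_right h1 (inv_pos.mpr ht).le
  linarith

/-- The outward unit normal at a boundary point is unique. -/
theorem IsOutwardNormal.unique {M : Set E3} (hM : IsClosed M) {p ν ν' : E3}
    (hp : p ∈ frontier M) (h : IsOutwardNormal M p ν) (h' : IsOutwardNormal M p ν') : ν = ν' := by
  by_contra hne
  have h1 : ‖ν‖ = 1 := h.1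
  have hin : inner ℝ ν ν' < 1 := by
    have : 0 < ‖ν - ν'‖ ^ 2 := by
      have := norm_pos_iff.mpr (sub_ne_zero.mpr hne)
      positivity
    rw [norm_sub_sq_real, h1, h'.1] at this
    linarith
  have hent := h.enters hM hp (v := ν' - ν) (by
    rw [inner_sub_right, real_inner_self_eq_norm_sq, h1]; linarith)
  obtain ⟨h1', r, hr, hloc, s, hs, hgrad⟩ := h'
  have hpos : 0 < s * inner ℝ ν' (ν' - ν) := by
    rw [inner_sub_right, real_inner_self_eq_norm_sq, h1', real_inner_comm]
    exact mul_pos hs (by linarith)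
  have hrp : 0 ≤ r p := by
    by_contra! hneg
    have : ∀ᶠ x in 𝓝 p, x ∈ M := by
      filter_upwards [hloc, hr.continuous.continuousAt.eventually_lt_const hneg] with x hx hx'
      exact hx.2 hx'.le
    exact hp.2 (mem_interior_iff_mem_nhds.mpr this)
  obtain ⟨t, a1, a2, a3, ht⟩ := (((slope_of_gradient hr hgrad (ν' - ν)).eventually_const_lt
    hpos).and (((tendsto_line p (ν' - ν)).eventually hloc).and
      (hent.and self_mem_nhdsWithin))).exists
  have b1 := (mul_pos_iff_of_pos_left (inv_pos.mpr ht)).mp a1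
  have b2 := a2.1 a3
  linarith

theorem IsCompactSmoothDomain.uniqueDiffOn {M : Set E3} (hM : IsCompactSmoothDomain M) :
    UniqueDiffOn ℝ M := by
  intro p hp
  by_cases hpi : p ∈ interior M
  · exact uniqueDiffWithinAt_of_mem_nhds (mem_interior_iff_mem_nhds.mp hpi)
  have hpf : p ∈ frontier M := ⟨subset_closure hp, hpi⟩
  obtain ⟨ν, hν⟩ := hM.2 p hpf
  have hsub : ∀ v : E3, inner ℝ ν v < 0 → v ∈ tangentConeAt ℝ M p := fun v hv =>
    mem_tangentConeAt_of_add_smul_mem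
      (c := fun t : ℝ => t) (l := 𝓝[>] 0)
      (Filter.tendsto_id'.mpr (nhdsGT_le_nhdsNE 0)) (hν.enters hM.1.isClosed hpf hv)
  refine ⟨?_, subset_closure hp⟩
  have htop : Submodule.span ℝ (tangentConeAt ℝ M p) = ⊤ := by
    refine Submodule.eq_top_iff'.mpr fun v => ?_
    have hνν : inner ℝ ν ν = (1 : ℝ) := by
      rw [real_inner_self_eq_norm_sq, hν.1]; norm_num
    set k : ℝ := |inner ℝ ν v| + 1 with hk
    have e1 : v - k • ν ∈ Submodule.span ℝ (tangentConeAt ℝ M p) := by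
      refine Submodule.subset_span (hsub _ ?_)
      rw [inner_sub_right, real_inner_smul_right, hνν]
      have := le_abs_self (inner ℝ ν v)
      linarith
    have e2 : -ν ∈ Submodule.span ℝ (tangentConeAt ℝ M p) := by
      refine Submodule.subset_span (hsub _ ?_)
      rw [inner_neg_right, hνν]; norm_num
    have := Submodule.sub_mem _ e1 (Submodule.smul_mem _ k e2)
    simpa using this
  rw [htop]
  simp

/-! ### Multiplication by continuous coefficients -/

theorem memLp_weight {K : Set E3} (hK : IsCompact K) {μ : Measure E3} {b : E3 → ℝ}
    (hb : ContinuousOn b K) {F : Type*} [NormedAddCommGroup F] [NormedSpace ℂ F] {f : E3 → F}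
    (hf : MemLp f 2 (μ.restrict K)) : MemLp (fun x => (b x : ℂ) • f x) 2 (μ.restrict K) := by
  obtain ⟨C, hC⟩ := hK.exists_bound_of_continuousOn hb
  have hbm : AEStronglyMeasurable (fun x => (b x : ℂ)) (μ.restrict K) :=
    Complex.continuous_ofReal.comp_aestronglyMeasurable
      (hb.aestronglyMeasurable_of_isCompact hK hK.measurableSet)
  refine hf.of_le_mul (c := C) (hbm.smul hf.1) ?_
  filter_upwards [ae_restrict_mem hK.measurableSet] with x hx
  rw [norm_smul, Complex.norm_real]
  exact mul_le_mul_of_nonneg_right (hC x hx) (norm_nonneg _)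

theorem memLp_dot {K : Set E3} (hK : IsCompact K) {μ : Measure E3} {a : E3 → E3}
    (ha : ContinuousOn a K) {f : E3 → C3} (hf : MemLp f 2 (μ.restrict K)) :
    MemLp (fun x => dotRC (a x) (f x)) 2 (μ.restrict K) := by
  obtain ⟨C, hC⟩ := hK.exists_bound_of_continuousOn ha
  have hcont : Continuous fun p : E3 × C3 => dotRC p.1 p.2 := by
    unfold dotRC; fun_prop
  have ham : AEStronglyMeasurable a (μ.restrict K) :=
    ha.aestronglyMeasurable_of_isCompact hK hK.measurableSet
  have hm : AEStronglyMeasurable (fun x => dotRC (a x) (f x)) (μ.restrict K) :=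
    hcont.comp_aestronglyMeasurable (f := fun x => (a x, f x)) (ham.prodMk hf.1)
  refine hf.of_le_mul (c := 3 * C) hm ?_
  filter_upwards [ae_restrict_mem hK.measurableSet] with x hx
  refine (norm_dotRC_le _ _).trans (mul_le_mul_of_nonneg_right ?_ (norm_nonneg _))
  linarith [hC x hx]

theorem integrable_conj_mul {μ : Measure E3} {f h : E3 → ℂ} (hf : MemLp f 2 μ)
    (hh : MemLp h 2 μ) : Integrable (fun x => conj (f x) * h x) μ := by
  have := MemLp.integrable_mul (p := 2) (q := 2) hf.star hh
  exact this

/-! ### The planet -/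

/-- The data of a rotating, self-gravitating, truncated gas planet: the region `M`, the sound speed
`c`, the unperturbed density `ρ` (written `ρ₀`), the unperturbed effective gravity `g`
(written `g₀'`), the rotation vector `Ω` and the gravitational constant `G`, with the regularity
assumptions on the coefficients and the consequences of hydrostatic equilibrium for their
directions. Only the values of `c`, `ρ` and `g` on `M` matter. -/
structure GasPlanet where
  M : Set E3
  c : E3 → ℝ
  ρ : E3 → ℝ
  g : E3 → E3
  Ω : E3
  G : ℝ
  domain_M : IsCompactSmoothDomain M
  continuous_c : ContinuousOn c M
  continuous_g : ContinuousOn g M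
  contDiff_ρ : ContDiffOn ℝ 1 ρ M
  c_sq_pos : ∀ x ∈ M, 0 < c x ^ 2
  ρ_pos : ∀ x ∈ M, 0 < ρ x
  /-- `g₀'` and `∇ρ₀` are parallel in `M`. -/
  parallel_gradρ : ∀ x ∈ M, ¬ LinearIndependent ℝ ![g x, gradientWithin ρ M x]
  /-- `g₀'` and the normal are parallel on `∂M`. -/
  parallel_normal : ∀ x ∈ frontier M, ¬ LinearIndependent ℝ ![g x, outwardNormal M x]
  /-- `g₀'` points into `M` on `∂M`. -/
  g_inward : ∀ x ∈ frontier M, inner ℝ (g x) (outwardNormal M x) < 0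
  G_pos : 0 < G

namespace GasPlanet

variable (P : GasPlanet)

/-- The outward unit normal `n` on `∂M`. -/
def n (x : E3) : E3 := outwardNormal P.M x

/-- The gradient of the unperturbed density. -/
def gradρ (x : E3) : E3 := gradientWithin P.ρ P.M x

/-- The bulk modulus `κ = c² ρ₀`. -/
def κ (x : E3) : ℝ := P.c x ^ 2 * P.ρ x

/-- The measure `ρ₀ dx` on `M`. -/
def mass : Measure E3 := (volume.restrict P.M).withDensity fun x => ENNReal.ofReal (P.ρ x)

/-- The surface measure on `∂M`. -/
def surface : Measure E3 := (μHE[2] : Measure E3).restrict (frontier P.M)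

/-- The Hilbert space `H = L²(ρ₀ dx)³`. -/
abbrev H : Type := Lp C3 2 P.mass

/-- The Hilbert space of triples `(u, d, t)` with `u ∈ H`, `d ∈ L²(M, ρ₀ dx)`, `t ∈ L²(∂M)`. -/
abbrev Triples : Type := WithLp 2 (P.H × WithLp 2 (Lp ℂ 2 P.mass × Lp ℂ 2 P.surface))

/-- The triples `(U|_M, ∇·U, n·U|_∂M)` of smooth vector fields `U ∈ C^∞(M)`, that is, of
restrictions to `M` of smooth vector fields. -/
def smoothTriples : Submodule ℂ P.Triples where
  carrier := {w | ∃ U : E3 → C3, ContDiff ℝ ∞ U ∧ w.fst =ᵐ[P.mass] U ∧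
    w.snd.fst =ᵐ[P.mass] div3 U ∧ w.snd.snd =ᵐ[P.surface] fun x => dotRC (P.n x) (U x)}
  zero_mem' := by
    refine ⟨0, contDiff_const, Lp.coeFn_zero _ _ _, ?_, ?_⟩
    · filter_upwards [Lp.coeFn_zero ℂ 2 P.mass] with x hx
      simp only [WithLp.zero_snd, WithLp.zero_fst]
      rw [hx]; simp [div3]
    · filter_upwards [Lp.coeFn_zero ℂ 2 P.surface] with x hx
      simp only [WithLp.zero_snd]
      rw [hx]; simp [dotRC]
  add_mem' := by
    rintro w w' ⟨U, hU, h1, h2, h3⟩ ⟨U', hU', h1', h2', h3'⟩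
    refine ⟨U + U', hU.add hU', ?_, ?_, ?_⟩
    · filter_upwards [Lp.coeFn_add w.fst w'.fst, h1, h1'] with x hx a b
      rw [WithLp.add_fst, hx, Pi.add_apply, a, b, Pi.add_apply]
    · filter_upwards [Lp.coeFn_add w.snd.fst w'.snd.fst, h2, h2'] with x hx a b
      rw [WithLp.add_snd, WithLp.add_fst, hx, Pi.add_apply, a, b, div3_add hU hU']
    · filter_upwards [Lp.coeFn_add w.snd.snd w'.snd.snd, h3, h3'] with x hx a b
      rw [WithLp.add_snd, WithLp.add_snd, hx, Pi.add_apply, a, b, Pi.add_apply, dotRC_add]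
  smul_mem' := by
    rintro k w ⟨U, hU, h1, h2, h3⟩
    refine ⟨k • U, contDiff_const.smul hU, ?_, ?_, ?_⟩
    · filter_upwards [Lp.coeFn_smul k w.fst, h1] with x hx a
      rw [WithLp.smul_fst, hx, Pi.smul_apply, a, Pi.smul_apply]
    · filter_upwards [Lp.coeFn_smul k w.snd.fst, h2] with x hx a
      rw [WithLp.smul_snd, WithLp.smul_fst, hx, Pi.smul_apply, a, div3_smul hU, smul_eq_mul]
    · filter_upwards [Lp.coeFn_smul k w.snd.snd, h3] with x hx a
      rw [WithLp.smul_snd, WithLp.smul_snd, hx, Pi.smul_apply, a, Pi.smul_apply, dotRC_smul,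
        smul_eq_mul]

/-- The space `H_Div(M, L²(∂M))`: the closure of `C^∞(M)` under the norm given by
`∫_M (|∇·u|² + |u|²) ρ₀ dx + ∫_∂M |n·u|² ds`. An element is recorded as the triple consisting of
the field `u`, its divergence `∇·u` and its normal trace `n·u` (both are determined by `u`). -/
def Hdiv : Submodule ℂ P.Triples := P.smoothTriples.topologicalClosure

/-- The field `u ∈ H` underlying an element of `H_Div(M, L²(∂M))`. -/
def field (w : P.Hdiv) : P.H := w.1.fst

/-- Its divergence. -/
def divergence (w : P.Hdiv) : Lp ℂ 2 P.mass := w.1.snd.fst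

/-- Its normal trace. -/
def normalTrace (w : P.Hdiv) : Lp ℂ 2 P.surface := w.1.snd.snd

/-! Integrability facts behind the definition of the energy form. -/

theorem isCompact_M : IsCompact P.M := P.domain_M.1

theorem isCompact_frontier : IsCompact (frontier P.M) :=
  P.isCompact_M.of_isClosed_subset isClosed_frontier P.isCompact_M.isClosed.frontier_subset

theorem continuous_ρ : ContinuousOn P.ρ P.M := P.contDiff_ρ.continuousOn

theorem continuous_κ : ContinuousOn P.κ P.M := (P.continuous_c.pow 2).mul P.continuous_ρ

theorem continuous_gradρ : ContinuousOn P.gradρ P.M :=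
  (InnerProductSpace.toDual ℝ E3).symm.continuous.comp_continuousOn
    (P.contDiff_ρ.continuousOn_fderivWithin P.domain_M.uniqueDiffOn (by simp))

theorem exists_restrict_le_mass :
    ∃ C : ℝ≥0∞, C ≠ ⊤ ∧ (volume.restrict P.M : Measure E3) ≤ C • P.mass := by
  obtain ⟨m, hm, hmρ⟩ : ∃ m : ℝ, 0 < m ∧ ∀ x ∈ P.M, m ≤ P.ρ x := by
    rcases P.M.eq_empty_or_nonempty with h | h
    · exact ⟨1, one_pos, by simp [h]⟩
    · obtain ⟨x, hx, hmin⟩ := P.isCompact_M.exists_isMinOn h P.continuous_ρ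
      exact ⟨P.ρ x, P.ρ_pos x hx, fun y hy => hmin hy⟩
  have hle : ENNReal.ofReal m • (volume.restrict P.M : Measure E3) ≤ P.mass := by
    rw [← withDensity_const]
    refine withDensity_mono ?_
    filter_upwards [ae_restrict_mem P.isCompact_M.measurableSet] with x hx
    exact ENNReal.ofReal_le_ofReal (hmρ x hx)
  have h0 : ENNReal.ofReal m ≠ 0 := by simpa using hm
  refine ⟨(ENNReal.ofReal m)⁻¹, ENNReal.inv_ne_top.mpr h0, ?_⟩
  calc (volume.restrict P.M : Measure E3)
      = (ENNReal.ofReal m)⁻¹ • ENNReal.ofReal m • volume.restrict P.M := by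
        rw [smul_smul, ENNReal.inv_mul_cancel h0 ENNReal.ofReal_ne_top, one_smul]
    _ ≤ (ENNReal.ofReal m)⁻¹ • P.mass := by gcongr

theorem memLp_of_mass {F : Type*} [NormedAddCommGroup F] {f : E3 → F} (hf : MemLp f 2 P.mass) :
    MemLp f 2 (volume.restrict P.M) :=
  let ⟨_, hC, hle⟩ := P.exists_restrict_le_mass
  hf.of_measure_le_smul hC hle

theorem ae_of_mass {p : E3 → Prop} (h : ∀ᵐ x ∂P.mass, p x) :
    ∀ᵐ x ∂(volume.restrict P.M), p x :=
  let ⟨_, _, hle⟩ := P.exists_restrict_le_mass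
  (Measure.absolutelyContinuous_of_le_smul hle).ae_le h

theorem continuous_weight :
    ContinuousOn (fun x => P.ρ x * inner ℝ (P.g x) (P.n x)) (frontier P.M) := by
  have hsub := P.isCompact_M.isClosed.frontier_subset
  have h : ContinuousOn (fun x => P.ρ x * -‖P.g x‖) (frontier P.M) :=
    (P.continuous_ρ.mul P.continuous_g.norm.neg).mono hsub
  refine h.congr fun x hx => ?_
  have hn : ‖P.n x‖ = 1 := (outwardNormal_spec P.domain_M hx).1
  have hpar := P.parallel_normal x hx
  have hneg := P.g_inward x hx
  change inner ℝ (P.g x) (P.n x) < 0 at hneg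
  change ¬ LinearIndependent ℝ ![P.g x, P.n x] at hpar
  have hn0 : P.n x ≠ 0 := fun h => by simp [h] at hn
  obtain ⟨s, hs⟩ : ∃ s : ℝ, P.g x = s • P.n x := by
    by_contra! hno
    refine hpar ?_
    rw [LinearIndependent.pair_symm_iff, LinearIndependent.pair_iff' hn0]
    exact fun a h => hno a h.symm
  have hnn : inner ℝ (P.n x) (P.n x) = (1 : ℝ) := by
    rw [real_inner_self_eq_norm_sq, hn]; norm_num
  rw [hs, real_inner_smul_left, hnn, mul_one] at hneg
  simp only
  rw [hs, real_inner_smul_left, hnn, norm_smul, hn, Real.norm_of_nonpos hneg.le]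
  ring

theorem memLp_massMotion (u : P.H) :
    MemLp (P.M.indicator fun x => (P.ρ x : ℂ) • u x) 2 (volume : Measure E3) :=
  (memLp_indicator_iff_restrict P.isCompact_M.measurableSet).mpr
    (memLp_weight P.isCompact_M P.continuous_ρ (P.memLp_of_mass (Lp.memLp u)))

/-- The map `u ↦ ρ₀ u` from `H` to `L²(ℝ³)³`, where `ρ₀ u` is extended by zero outside `M`. -/
def massMotion : P.H →ₗ[ℂ] Lp C3 2 (volume : Measure E3) where
  toFun u := (P.memLp_massMotion u).toLp _
  map_add' u u' := by
    rw [← MemLp.toLp_add]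
    refine MemLp.toLp_congr _ _ ?_
    have := P.ae_of_mass (Lp.coeFn_add u u')
    rw [ae_restrict_iff' P.isCompact_M.measurableSet] at this
    filter_upwards [this] with x hx
    by_cases hxM : x ∈ P.M
    · simp only [Pi.add_apply, Set.indicator_of_mem hxM, hx hxM, smul_add]
    · simp [hxM]
  map_smul' k u := by
    rw [RingHom.id_apply, ← MemLp.toLp_const_smul]
    refine MemLp.toLp_congr _ _ ?_
    have := P.ae_of_mass (Lp.coeFn_smul k u)
    rw [ae_restrict_iff' P.isCompact_M.measurableSet] at this
    filter_upwards [this] with x hx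
    by_cases hxM : x ∈ P.M
    · simp [hxM, hx hxM, smul_comm k]
    · simp [hxM]

/-- The integrand over `M` of the energy form,
`κ (∇·v̄)(∇·u) + ρ₀ (∇·v̄)(g₀'·u) + (g₀'·v̄)(∇·(ρ₀ u))`, where
`∇·(ρ₀ u) = ρ₀ ∇·u + ∇ρ₀·u`. -/
def bulkDensity (v u : P.Hdiv) (x : E3) : ℂ :=
  P.κ x * conj (P.divergence v x) * P.divergence u x
    + P.ρ x * conj (P.divergence v x) * dotRC (P.g x) (P.field u x)
    + conj (dotRC (P.g x) (P.field v x))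
        * (P.ρ x * P.divergence u x + dotRC (P.gradρ x) (P.field u x))

/-- The integrand over `∂M` of the energy form, `(n·v̄) ρ₀ (g₀'·u)`. Since `g₀'` and `n` are
parallel on `∂M`, one has `g₀'·u = (g₀'·n)(n·u)`, which only involves the normal trace of `u`. -/
def boundaryDensity (v u : P.Hdiv) (x : E3) : ℂ :=
  conj (P.normalTrace v x)
    * (((P.ρ x * inner ℝ (P.g x) (P.n x) : ℝ) : ℂ) * P.normalTrace u x)

/-- The energy form
`a₂(v, u) = ∫_M κ (∇·v̄)(∇·u) + ρ₀ (∇·v̄)(g₀'·u) + (g₀'·v̄)(∇·(ρ₀ u)) dx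
  - (4πG)⁻¹ ∫_ℝ³ ∇S(ρ₀ v̄) · ∇S(ρ₀ u) dx - ∫_∂M (n·v̄) ρ₀ (g₀'·u) ds`
on `H_Div(M, L²(∂M))`. -/
def a₂ (v u : P.Hdiv) : ℂ :=
  (∫ x in P.M, P.bulkDensity v u x)
    - ((1 / (4 * Real.pi * P.G) : ℝ) : ℂ)
        * inner ℂ (gravityGradient P.G (P.massMotion (P.field v)))
            (gravityGradient P.G (P.massMotion (P.field u)))
    - ∫ x, P.boundaryDensity v u x ∂P.surface

theorem integrable_bulkDensity (v u : P.Hdiv) :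
    Integrable (P.bulkDensity v u) (volume.restrict P.M) := by
  have hM := P.isCompact_M
  have du := P.memLp_of_mass (Lp.memLp (P.divergence u))
  have dv := P.memLp_of_mass (Lp.memLp (P.divergence v))
  have fu := P.memLp_of_mass (Lp.memLp (P.field u))
  have fv := P.memLp_of_mass (Lp.memLp (P.field v))
  have i1 := integrable_conj_mul dv (memLp_weight hM P.continuous_κ du)
  have i2 := integrable_conj_mul dv
    (memLp_weight hM P.continuous_ρ (memLp_dot hM P.continuous_g fu))
  have i3 := integrable_conj_mul (memLp_dot hM P.continuous_g fv)
    ((memLp_weight hM P.continuous_ρ du).add (memLp_dot hM P.continuous_gradρ fu))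
  refine ((i1.add i2).add i3).congr (Filter.Eventually.of_forall fun x => ?_)
  simp only [bulkDensity, Pi.add_apply, smul_eq_mul]
  ring

theorem integrable_boundaryDensity (v u : P.Hdiv) :
    Integrable (P.boundaryDensity v u) P.surface :=
  integrable_conj_mul (Lp.memLp (P.normalTrace v))
    (memLp_weight P.isCompact_frontier P.continuous_weight (Lp.memLp (P.normalTrace u)))

theorem a₂_add_right (v u u' : P.Hdiv) : P.a₂ v (u + u') = P.a₂ v u + P.a₂ v u' := by
  have h1 : (∫ x in P.M, P.bulkDensity v (u + u') x)
      = (∫ x in P.M, P.bulkDensity v u x) + ∫ x in P.M, P.bulkDensity v u' x := by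
    rw [← integral_add (P.integrable_bulkDensity v u) (P.integrable_bulkDensity v u')]
    refine integral_congr_ae ?_
    filter_upwards [P.ae_of_mass (Lp.coeFn_add (P.field u) (P.field u')),
      P.ae_of_mass (Lp.coeFn_add (P.divergence u) (P.divergence u'))] with x hx hx'
    change (P.field (u + u')) x = _ at hx
    change (P.divergence (u + u')) x = _ at hx'
    simp only [bulkDensity, hx, hx', Pi.add_apply, dotRC_add]
    ring
  have h2 : (∫ x, P.boundaryDensity v (u + u') x ∂P.surface)
      = (∫ x, P.boundaryDensity v u x ∂P.surface) + ∫ x, P.boundaryDensity v u' x ∂P.surface := by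
    rw [← integral_add (P.integrable_boundaryDensity v u) (P.integrable_boundaryDensity v u')]
    refine integral_congr_ae ?_
    filter_upwards [Lp.coeFn_add (P.normalTrace u) (P.normalTrace u')] with x hx
    change (P.normalTrace (u + u')) x = _ at hx
    simp only [boundaryDensity, hx, Pi.add_apply]
    ring
  have h3 : P.field (u + u') = P.field u + P.field u' := rfl
  simp only [a₂, h1, h2, h3, map_add, inner_add_right]
  ring

theorem a₂_smul_right (k : ℂ) (v u : P.Hdiv) : P.a₂ v (k • u) = k * P.a₂ v u := by
  have h1 : (∫ x in P.M, P.bulkDensity v (k • u) x)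
      = k * ∫ x in P.M, P.bulkDensity v u x := by
    rw [← integral_const_mul]
    refine integral_congr_ae ?_
    filter_upwards [P.ae_of_mass (Lp.coeFn_smul k (P.field u)),
      P.ae_of_mass (Lp.coeFn_smul k (P.divergence u))] with x hx hx'
    change (P.field (k • u)) x = _ at hx
    change (P.divergence (k • u)) x = _ at hx'
    simp only [bulkDensity, hx, hx', Pi.smul_apply, dotRC_smul, smul_eq_mul]
    ring
  have h2 : (∫ x, P.boundaryDensity v (k • u) x ∂P.surface)
      = k * ∫ x, P.boundaryDensity v u x ∂P.surface := by
    rw [← integral_const_mul]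
    refine integral_congr_ae ?_
    filter_upwards [Lp.coeFn_smul k (P.normalTrace u)] with x hx
    change (P.normalTrace (k • u)) x = _ at hx
    simp only [boundaryDensity, hx, Pi.smul_apply, smul_eq_mul]
    ring
  have h3 : P.field (k • u) = k • P.field u := rfl
  simp only [a₂, h1, h2, h3, map_smul, inner_smul_right]
  ring

/-! ### The operator `A₂` and the pencil `L` -/

/-- The graph of `A₂`: the pairs `(u, f)` with `u ∈ H_Div(M, L²(∂M))`, `f ∈ H` and
`a₂(v, u) = ⟨v, f⟩_H` for all `v ∈ H_Div(M, L²(∂M))`. Such an `f` exists if and only if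
`v ↦ a₂(v, u)` is continuous with respect to the norm of `H`, and then it is unique. -/
def A₂graph : Submodule ℂ (P.H × P.H) where
  carrier := {p | ∃ u : P.Hdiv, P.field u = p.1 ∧
    ∀ v : P.Hdiv, P.a₂ v u = inner ℂ (P.field v) p.2}
  zero_mem' := ⟨0, rfl, fun v => by
    have := P.a₂_smul_right 0 v 0
    rw [zero_smul, zero_mul] at this
    rw [this, Prod.snd_zero, inner_zero_right]⟩
  add_mem' := by
    rintro p q ⟨u, hu, h⟩ ⟨u', hu', h'⟩
    refine ⟨u + u', ?_, fun v => ?_⟩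
    · rw [Prod.fst_add, ← hu, ← hu']; rfl
    · rw [a₂_add_right, h, h', Prod.snd_add, inner_add_right]
  smul_mem' := by
    rintro k p ⟨u, hu, h⟩
    refine ⟨k • u, ?_, fun v => ?_⟩
    · rw [Prod.smul_fst, ← hu]; rfl
    · rw [a₂_smul_right, h, Prod.smul_snd, inner_smul_right]

/-- The unbounded operator `A₂` in `H` associated with the form `a₂`, with domain
`D(A₂) = {u ∈ H_Div(M, L²(∂M)) : v ↦ a₂(v, u) is continuous for the norm of H}`. -/
def A₂ : P.H →ₗ.[ℂ] P.H := P.A₂graph.toLinearPMap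

/-- The bounded operator `R_Ω u = Ω × u` in `H`. -/
def R : P.H →L[ℂ] P.H := (crossRC P.Ω).compLpL 2 P.mass

/-- The quadratic operator pencil `L(λ) = λ² Id + 2 λ R_Ω + A₂`, with domain `D(A₂)`. -/
def L (z : ℂ) : P.H →ₗ.[ℂ] P.H :=
  (z ^ 2 • ContinuousLinearMap.id ℂ P.H + (2 * z) • P.R).toLinearMap +ᵥ P.A₂

end GasPlanet

end

/-! ### Coercive forms on Hilbert spaces -/

/-! For `u` in the form domain put `N = ‖u‖²` (norm of `H`) and `a = a₂(u, u)`. The form is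
Hermitian, so `a` is real; `R_Ω` is skew-adjoint with norm at most `|Ω|`, so `⟨u, R_Ω u⟩ = iβ` with
`|β| ≤ |Ω| N`. The form of `L(z)` at `u` is therefore `p = z² N + 2z iβ + a` (`pencilForm_self`).
The real and imaginary parts of `z̄ p` are `Re z (|z|² N + a)` and `Im z (|z|² N - a) + 2|z|² β`. If
`p = 0` with `Re z ≠ 0` and `N > 0`, the first gives `a = -|z|² N`, whence `|z|² ≤ -γ`; inserted in
the second, it gives `Im z = -β/N`, whence `|Im z| ≤ |Ω|`.

This excludes eigenvalues only. To exclude spectrum the argument is made quantitative: by the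
Gårding inequality `a ≥ c ‖u‖² - C N`, in the norm of `H_Div` (`exists_garding`), the same two
identities bound `|p|` below by a multiple of `‖u‖²` (`quadratic_coercive_of_abs_im_gt`,
`quadratic_coercive_of_lowerBound`). Lax–Milgram then inverts `L(z)`
(`mem_resolventSet_of_coercive`).

The Gårding inequality holds because `κ > 0` controls the divergence, inward gravity makes the
boundary term control the normal trace, and all the rest is absorbed or bounded in `H`. Since `γ`
bounds `A₂` only on its domain, it must first be carried over to the whole form domain
(`lowerBound_of_operator_lowerBound`). -/

section Abstract

variable {V H : Type*} [NormedAddCommGroup V] [InnerProductSpace ℂ V]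
  [NormedAddCommGroup H] [InnerProductSpace ℂ H]

/-- A bounded form on `V`, conjugate-linear in the first argument. -/
structure IsBoundedForm (b : V → V → ℂ) : Prop where
  add_left : ∀ v v' u, b (v + v') u = b v u + b v' u
  smul_left : ∀ (k : ℂ) v u, b (k • v) u = conj k * b v u
  add_right : ∀ v u u', b v (u + u') = b v u + b v u'
  smul_right : ∀ (k : ℂ) v u, b v (k • u) = k * b v u
  bound : ∃ K : ℝ, ∀ v u, ‖b v u‖ ≤ K * ‖v‖ * ‖u‖

theorem IsBoundedForm.exists_eq_inner [CompleteSpace V] {b : V → V → ℂ} (hb : IsBoundedForm b) :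
    ∃ T : V →L[ℂ] V, ∀ v u, b v u = inner ℂ (T v) u := by
  obtain ⟨K, hK⟩ := hb.bound
  let B : V →L⋆[ℂ] V →L[ℂ] ℂ := LinearMap.mkContinuous₂
    (LinearMap.mk₂'ₛₗ (starRingEnd ℂ) (RingHom.id ℂ) b hb.add_left hb.smul_left
      hb.add_right hb.smul_right) K hK
  refine ⟨InnerProductSpace.continuousLinearMapOfBilin B, fun v u => ?_⟩
  rw [InnerProductSpace.continuousLinearMapOfBilin_apply]
  rfl

/-- Serves twice: to shift a form by a multiple of the inner product of `H`, and to add the terms of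
order one and two in `z` to `a₂`. -/
theorem IsBoundedForm.add_inner {b : V → V → ℂ} (hb : IsBoundedForm b) {j : V → H}
    (hj : IsBoundedLinearMap ℂ j) (S : H →L[ℂ] H) :
    IsBoundedForm fun v u => b v u + inner ℂ (j v) (S (j u)) := by
  obtain ⟨K, hK⟩ := hb.bound
  obtain ⟨C, hC, hjC⟩ := hj.bound
  refine ⟨fun v v' u => ?_, fun k v u => ?_, fun v u u' => ?_, fun k v u => ?_,
    K + C * ‖S‖ * C, fun v u => ?_⟩
  · rw [hb.add_left, hj.map_add, inner_add_left]; ring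
  · rw [hb.smul_left, hj.map_smul, inner_smul_left]; ring
  · rw [hb.add_right, hj.map_add, map_add, inner_add_right]; ring
  · rw [hb.smul_right, hj.map_smul, map_smul, inner_smul_right]; ring
  · have h1 : ‖(inner ℂ (j v) (S (j u)) : ℂ)‖ ≤ (C * ‖v‖) * (‖S‖ * (C * ‖u‖)) := by
      refine (norm_inner_le_norm _ _).trans ?_
      have h2 := S.le_opNorm_of_le (hjC u)
      have h3 := hjC v
      gcongr
    refine (norm_add_le _ _).trans ?_
    linarith [hK v u]

variable [CompleteSpace V] [CompleteSpace H]

/-- Lax–Milgram for a form that is coercive in modulus. -/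
theorem IsBoundedForm.exists_forall_eq_of_coercive {b : V → V → ℂ} (hb : IsBoundedForm b) {c : ℝ}
    (hc : 0 < c) (h : ∀ u, c * ‖u‖ ^ 2 ≤ ‖b u u‖) {j : V → H} (hj : IsBoundedLinearMap ℂ j)
    (f : H) : ∃ u, ∀ v, b v u = inner ℂ (j v) f := by
  obtain ⟨T, hT⟩ := hb.exists_eq_inner
  -- The unknown is the second argument, so the operator to invert is the adjoint: `b v u = ⟨v, T*
  -- u⟩`.
  have hTu : IsUnit (ContinuousLinearMap.adjoint T) :=
    ContinuousLinearMap.isUnit_of_forall_le_norm_inner_map _ (c := ⟨c, hc.le⟩) hc fun u => by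
      rw [norm_inner_symm, ContinuousLinearMap.adjoint_inner_right, ← hT, mul_comm]
      exact h u
  obtain ⟨u, hu⟩ := (ContinuousLinearMap.isUnit_iff_bijective.mp hTu).2
    (ContinuousLinearMap.adjoint hj.toContinuousLinearMap f)
  refine ⟨u, fun v => ?_⟩
  rw [hT, ← ContinuousLinearMap.adjoint_inner_right, hu, ContinuousLinearMap.adjoint_inner_right]
  rfl

/-- A lower bound of the operator associated with a semibounded closed symmetric form is a lower
bound of the form. -/
theorem IsBoundedForm.lowerBound_of_operator_lowerBound {a : V → V → ℂ} (ha : IsBoundedForm a)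
    {j : V → H} (hj : IsBoundedLinearMap ℂ j)
    (hT : ∀ u v, conj (a u v) = a v u) {c C γ : ℝ} (hc : 0 < c)
    (hG : ∀ u, c * ‖u‖ ^ 2 - C * ‖j u‖ ^ 2 ≤ (a u u).re)
    (hγ : ∀ u f, (∀ v, a v u = inner ℂ (j v) f) →
      γ * ‖j u‖ ^ 2 ≤ (inner ℂ (j u) f : ℂ).re) (w : V) :
    γ * ‖j w‖ ^ 2 ≤ (a w w).re := by
  obtain ⟨b, hbdef⟩ : ∃ b : V → V → ℂ, b = fun v u =>
    a v u + inner ℂ (j v) (((C : ℂ) • ContinuousLinearMap.id ℂ H) (j u)) := ⟨_, rfl⟩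
  have hb : IsBoundedForm b := hbdef ▸ ha.add_inner hj _
  have hB : ∀ v u, b v u = a v u + C * inner ℂ (j v) (j u) := by
    intro v u
    simp [hbdef]
  have hBre : ∀ u, (b u u).re = (a u u).re + C * ‖j u‖ ^ 2 := by
    intro u
    rw [hB, Complex.add_re, Complex.re_ofReal_mul]
    congr 2
    exact inner_self_eq_norm_sq (𝕜 := ℂ) (j u)
  have hco : ∀ u, c * ‖u‖ ^ 2 ≤ (b u u).re := fun u => by
    rw [hBre]; linarith [hG u]
  have hpos : ∀ u, 0 ≤ (b u u).re := fun u => le_trans (by positivity) (hco u)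
  -- If `γ ≤ -C`, the claim is already weaker than the Gårding bound.
  rcases le_or_gt (γ + C) 0 with hδ | hδ
  · have h1 := hpos w
    rw [hBre] at h1
    nlinarith [sq_nonneg ‖j w‖]
  -- Here `s` is the resolvent at `-C` applied to `j w`. It lies in the operator domain, so `hγ`
  -- applies to it; no density of that domain in `V` is needed.
  obtain ⟨s, hs⟩ := hb.exists_forall_eq_of_coercive hc
    (fun u => (hco u).trans (Complex.re_le_norm _)) hj (j w)
  have hsT : ∀ v, (a v s) = inner ℂ (j v) (j w - (C : ℂ) • j s) := fun v => by
    have := hs v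
    rw [hB] at this
    rw [inner_sub_right, inner_smul_right, ← this]; ring
  have h1 := hγ s _ hsT
  rw [← hsT] at h1
  have h2 : (γ + C) * ‖j s‖ ^ 2 ≤ (b s s).re := by rw [hBre]; linarith
  have h3 : (b s s).re ≤ ‖j s‖ * ‖j w‖ := by
    rw [hs]; exact (Complex.re_le_norm _).trans (norm_inner_le_norm _ _)
  have h4 : (γ + C) * (b s s).re ≤ ‖j w‖ ^ 2 := by
    have h5 : (γ + C) * ‖j s‖ ≤ ‖j w‖ := by
      by_contra! hlt
      have hjs : 0 < ‖j s‖ := by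
        by_contra! h0
        have : ‖j s‖ = 0 := le_antisymm h0 (norm_nonneg _)
        rw [this, mul_zero] at hlt
        exact absurd hlt (not_lt.mpr (norm_nonneg _))
      nlinarith
    nlinarith [norm_nonneg (j w), norm_nonneg (j s)]
  -- With `δ = γ + C`, positivity of `b` at `w - δ s` reads `b(w,w) - 2δ ‖j w‖² + δ² b(s,s) ≥ 0`. As
  -- `δ b(s,s) ≤ ‖j w‖²` by `h4`, this leaves `b(w,w) ≥ δ ‖j w‖²`.
  have h6 := hpos (w - ((γ + C : ℝ) : ℂ) • s)
  have hsw : (b w s).re = ‖j w‖ ^ 2 := by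
    rw [hs, inner_self_eq_norm_sq_to_K]; norm_cast
  have hws : (b s w).re = ‖j w‖ ^ 2 := by
    have : b s w = conj (b w s) := by
      rw [hB, hB, map_add, map_mul, hT, inner_conj_symm, Complex.conj_ofReal]
    rw [this, Complex.conj_re, hsw]
  have h7 : (b (w - ((γ + C : ℝ) : ℂ) • s) (w - ((γ + C : ℝ) : ℂ) • s)).re
      = (b w w).re - (γ + C) * ‖j w‖ ^ 2 - (γ + C) * ‖j w‖ ^ 2
        + (γ + C) * ((γ + C) * (b s s).re) := by
    rw [sub_eq_add_neg, ← neg_smul, hb.add_left, hb.add_right, hb.add_right, hb.smul_left,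
      hb.smul_left, hb.smul_right, hb.smul_right, map_neg, Complex.conj_ofReal]
    simp only [Complex.add_re, neg_mul, mul_neg, Complex.neg_re, Complex.re_ofReal_mul, hsw, hws]
    ring
  rw [h7, hBre] at h6
  have h8 := mul_le_mul_of_nonneg_left h4 hδ.le
  linarith

end Abstract

/-! ### Coercivity of the quadratic eigenvalue polynomial -/

/-- The quadratic polynomial `z² N + 2 z (iβ) + a`, times `z̄`. -/
theorem conj_mul_quadratic (z : ℂ) (N β a : ℝ) :
    (conj z * (z ^ 2 * N + 2 * z * (β * Complex.I) + a)).re = z.re * (‖z‖ ^ 2 * N + a) ∧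
    (conj z * (z ^ 2 * N + 2 * z * (β * Complex.I) + a)).im
      = z.im * (‖z‖ ^ 2 * N - a) + 2 * ‖z‖ ^ 2 * β := by
  rw [← Complex.normSq_eq_norm_sq, Complex.normSq_apply]
  constructor <;> simp [pow_two] <;> ring

/-- Adding `|Im z|` times `|z|² N + a` to the imaginary part of `z̄ p` cancels `a` and leaves `2|z|²
(|Im z| - b) N`, up to signs. The weight `(1 + ε)|Im z|` keeps `ε |Im z| a` as well, which yields
the `W` term at the price of a small multiple of `N`. -/
theorem quadratic_coercive_of_abs_im_gt {z : ℂ} (hx : z.re ≠ 0) {b c C : ℝ} (hb : 0 ≤ b)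
    (hz : b < |z.im|) (hc : 0 < c) (hC : 0 ≤ C) :
    ∃ k : ℝ, 0 < k ∧ ∀ N W a β : ℝ, 0 ≤ N → |β| ≤ b * N → c * W - C * N ≤ a →
      k * W ≤ ‖z ^ 2 * N + 2 * z * (β * Complex.I) + a‖ := by
  have hy : 0 < |z.im| := hb.trans_lt hz
  have hz0 : 0 < ‖z‖ := norm_pos_iff.mpr fun h => hx (by simp [h])
  set D := |z.im| - b with hD
  have hDpos : 0 < D := sub_pos.mpr hz
  -- Chosen so that the loss `|Im z| ε C N` is covered by the gain `2|z|² D N`; `C + 1` rather than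
  -- `C` allows `C = 0`.
  set ε := 2 * ‖z‖ ^ 2 * D / (|z.im| * (C + 1)) with hε
  have hεpos : 0 < ε := by positivity
  have hεC : |z.im| * ε * (C + 1) = 2 * ‖z‖ ^ 2 * D := by rw [hε]; field_simp
  set q := (1 + ε) * (|z.im| / |z.re|) with hq
  have hx' : 0 < |z.re| := abs_pos.mpr hx
  have hq0 : 0 ≤ q := by positivity
  refine ⟨|z.im| * ε * c / ((1 + q) * ‖z‖), by positivity, fun N W a β hN hβ ha => ?_⟩
  set p := z ^ 2 * N + 2 * z * (β * Complex.I) + a with hp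
  obtain ⟨hre, him⟩ := conj_mul_quadratic z N β a
  rw [← hp] at hre him
  have hnorm : ‖conj z * p‖ = ‖z‖ * ‖p‖ := by rw [norm_mul, Complex.norm_conj]
  have h1 := Complex.abs_re_le_norm (conj z * p)
  have h2 := Complex.abs_im_le_norm (conj z * p)
  rw [hre, hnorm, abs_mul] at h1
  rw [him, hnorm] at h2
  have h3 : q * (|z.re| * |‖z‖ ^ 2 * N + a|) = (1 + ε) * |z.im| * |‖z‖ ^ 2 * N + a| := by
    rw [hq]; field_simp
  have h4 := mul_le_mul_of_nonneg_left h1 hq0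
  rw [h3] at h4
  have h5 : |z.im| * (‖z‖ ^ 2 * N - a) - 2 * ‖z‖ ^ 2 * (b * N)
      ≤ |z.im * (‖z‖ ^ 2 * N - a) + 2 * ‖z‖ ^ 2 * β| := by
    have e1 : |z.im| * (‖z‖ ^ 2 * N - a) ≤ |z.im * (‖z‖ ^ 2 * N - a)| := by
      rw [abs_mul]; exact mul_le_mul_of_nonneg_left (le_abs_self _) hy.le
    have e2 : |2 * ‖z‖ ^ 2 * β| ≤ 2 * ‖z‖ ^ 2 * (b * N) := by
      rw [abs_mul, abs_of_nonneg (by positivity)]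
      exact mul_le_mul_of_nonneg_left hβ (by positivity)
    have e3 := abs_sub_abs_le_abs_sub (z.im * (‖z‖ ^ 2 * N - a)) (-(2 * ‖z‖ ^ 2 * β))
    rw [sub_neg_eq_add, abs_neg] at e3
    linarith
  have h6 : (1 + ε) * |z.im| * (‖z‖ ^ 2 * N + a) ≤ (1 + ε) * |z.im| * |‖z‖ ^ 2 * N + a| :=
    mul_le_mul_of_nonneg_left (le_abs_self _) (by positivity)
  have h7 : |z.im| * ε * (c * W - C * N) ≤ |z.im| * ε * a :=
    mul_le_mul_of_nonneg_left ha (by positivity)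
  have h8 : 0 ≤ |z.im| * ε * N := by positivity
  have h9 : 0 ≤ |z.im| * ε * ‖z‖ ^ 2 * N := by positivity
  have h10 : |z.im| * ε * (C + 1) * N = 2 * ‖z‖ ^ 2 * (|z.im| - b) * N := by rw [hεC, hD]
  rw [div_mul_eq_mul_div, div_le_iff₀ (by positivity)]
  nlinarith

/-- The real part of `z̄ p` does not see `β`. Both `D N` and `c W - C N` bound `|z|² N + a` from
below; the convex combination with weights `C/(D + C)` and `D/(D + C)` eliminates `N`. -/
theorem quadratic_coercive_of_lowerBound {z : ℂ} (hx : z.re ≠ 0) {γ c C : ℝ}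
    (hz : -γ < ‖z‖ ^ 2) (hc : 0 < c) (hC : 0 ≤ C) :
    ∃ k : ℝ, 0 < k ∧ ∀ N W a β : ℝ, 0 ≤ N → 0 ≤ W → γ * N ≤ a → c * W - C * N ≤ a →
      k * W ≤ ‖z ^ 2 * N + 2 * z * (β * Complex.I) + a‖ := by
  have hz0 : 0 < ‖z‖ := norm_pos_iff.mpr fun h => hx (by simp [h])
  have hx' : 0 < |z.re| := abs_pos.mpr hx
  set D := ‖z‖ ^ 2 + γ with hD
  have hDpos : 0 < D := by linarith
  refine ⟨|z.re| * (D / (D + C)) * c / ‖z‖, by positivity, fun N W a β hN hW hγ ha => ?_⟩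
  set p := z ^ 2 * N + 2 * z * (β * Complex.I) + a with hp
  obtain ⟨hre, -⟩ := conj_mul_quadratic z N β a
  rw [← hp] at hre
  have h1 := Complex.abs_re_le_norm (conj z * p)
  rw [hre, norm_mul, Complex.norm_conj, abs_mul] at h1
  have h2 := mul_le_mul_of_nonneg_left (le_abs_self (‖z‖ ^ 2 * N + a)) hx'.le
  have h3 : D / (D + C) * c * W ≤ ‖z‖ ^ 2 * N + a := by
    rw [div_mul_eq_mul_div, div_mul_eq_mul_div, div_le_iff₀ (by positivity)]
    have e1 : D * N ≤ ‖z‖ ^ 2 * N + a := by rw [hD]; linarith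
    have e2 := mul_le_mul_of_nonneg_right e1 hC
    have e3 := mul_le_mul_of_nonneg_left ha hDpos.le
    have e4 : 0 ≤ D * (‖z‖ ^ 2 * N) := by positivity
    linarith
  have h4 := mul_le_mul_of_nonneg_left h3 hx'.le
  rw [div_mul_eq_mul_div, div_le_iff₀ hz0]
  linarith

/-! ### The boundary of a smooth domain is a null set -/

/-- The regular part of a level set is a null set. -/
theorem volume_regular_levelSet {r : E3 → ℝ} (hr : Differentiable ℝ r) :
    volume {x : E3 | r x = 0 ∧ fderiv ℝ r x ≠ 0} = 0 := by
  set S := {x : E3 | r x = 0 ∧ fderiv ℝ r x ≠ 0} with hS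
  have hv : ∀ x : E3, ∃ v : E3, x ∈ S → fderiv ℝ r x v = 1 := by
    intro x
    by_cases hx : x ∈ S
    · obtain ⟨v, hv⟩ : ∃ v, fderiv ℝ r x v ≠ 0 := by
        by_contra! h
        exact hx.2 (ContinuousLinearMap.ext h)
      exact ⟨(fderiv ℝ r x v)⁻¹ • v, fun _ => by simp [hv]⟩
    · exact ⟨0, fun h => absurd h hx⟩
  choose v hv using hv
  -- On `S` the identity equals `y ↦ y - r(y) v`, whose derivative at `x` kills `v` because `dr(v) =
  -- 1`. So the identity has a singular derivative within `S`, and the easy case of Sard's theorem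
  -- makes its image `S` null.
  have key := MeasureTheory.addHaar_image_eq_zero_of_det_fderivWithin_eq_zero
    (volume : Measure E3) (f := fun x => x) (s := S)
    (f' := fun x => ContinuousLinearMap.id ℝ E3 - (fderiv ℝ r x).smulRight (v x))
    (fun x hx => by
      have h1 : HasFDerivWithinAt (fun y => y - r y • v x)
          (ContinuousLinearMap.id ℝ E3 - (fderiv ℝ r x).smulRight (v x)) S x :=
        (hasFDerivWithinAt_id x S).sub ((hr x).hasFDerivAt.hasFDerivWithinAt.smul_const (v x))
      exact h1.congr (fun y hy => by simp [hy.1]) (by simp [hx.1]))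
    (fun x hx => by
      have hvx := hv x hx
      have hv0 : v x ≠ 0 := fun h => by simp [h] at hvx
      by_contra hdet
      have hinj : LinearMap.ker ((ContinuousLinearMap.id ℝ E3
        - (fderiv ℝ r x).smulRight (v x) : E3 →L[ℝ] E3) : E3 →ₗ[ℝ] E3) = ⊥ :=
        ((LinearMap.equivOfDetNeZero _ hdet)).ker
      have hmem : v x ∈ LinearMap.ker ((ContinuousLinearMap.id ℝ E3
        - (fderiv ℝ r x).smulRight (v x) : E3 →L[ℝ] E3) : E3 →ₗ[ℝ] E3) := by
        simp [hvx]
      rw [hinj] at hmem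
      exact hv0 (by simpa using hmem))
  simpa using key

/-- Locally the boundary lies in the regular zero set of a defining function. Needed so that test
fields supported in the interior are dense in `H`. -/
theorem IsCompactSmoothDomain.volume_frontier {M : Set E3} (hM : IsCompactSmoothDomain M) :
    volume (frontier M) = 0 := by
  refine measure_null_of_locally_null _ fun p hp => ?_
  obtain ⟨ν, hν, r, hr, hloc, s, hs, hgrad⟩ := hM.2 p hp
  have hfd : fderiv ℝ r p ≠ 0 := by
    intro h0
    have h1 : s • ν = 0 := by rw [← hgrad, gradient, h0, map_zero]
    have hν0 : ν ≠ 0 := fun h => by simp [h] at hν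
    exact (smul_ne_zero hs.ne' hν0) h1
  have hreg : ∀ᶠ x in 𝓝 p, fderiv ℝ r x ≠ 0 :=
    (hr.continuous_fderiv (by simp)).continuousAt.eventually_ne hfd
  refine ⟨{x | (x ∈ frontier M → r x = 0 ∧ fderiv ℝ r x ≠ 0)} ∩ frontier M,
    Filter.inter_mem ?_ self_mem_nhdsWithin, ?_⟩
  · refine nhdsWithin_le_nhds ?_
    filter_upwards [hloc.eventually_nhds, hreg] with x hx hx' hxf
    refine ⟨?_, hx'⟩
    refine le_antisymm (hx.self_of_nhds.1 (hM.1.isClosed.frontier_subset hxf)) ?_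
    by_contra! hneg
    refine hxf.2 (mem_interior_iff_mem_nhds.mpr ?_)
    filter_upwards [hx, hr.continuous.continuousAt.eventually_lt_const hneg] with y hy hy'
    exact hy.2 hy'.le
  · exact measure_mono_null (fun x hx => hx.1 hx.2)
      (volume_regular_levelSet (hr.differentiable (by simp)))

/-! ### The cross product -/

theorem crossRC_apply (a : E3) (z : C3) : crossRC a z = WithLp.toLp 2
    ![a 1 * z 2 - a 2 * z 1, a 2 * z 0 - a 0 * z 2, a 0 * z 1 - a 1 * z 0] := by
  ext i
  fin_cases i <;> simp [crossRC, crossProduct]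

/-- The matrix of `z ↦ a × z` is real and antisymmetric, hence skew-Hermitian. -/
theorem inner_crossRC_re (a : E3) (z : C3) : (inner ℂ z (crossRC a z) : ℂ).re = 0 := by
  rw [crossRC_apply, PiLp.inner_apply]
  simp [Fin.sum_univ_three]
  ring

/-- Lagrange's identity on real and imaginary parts: the defect of the squares is `(a · Re z)² + (a
· Im z)²`. The constant `1` is what makes the strip have half-width exactly `|Ω|`. -/
theorem norm_crossRC_le (a : E3) (z : C3) : ‖crossRC a z‖ ≤ ‖a‖ * ‖z‖ := by
  refine (sq_le_sq₀ (norm_nonneg _) (by positivity)).mp ?_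
  rw [crossRC_apply, mul_pow, EuclideanSpace.norm_sq_eq, EuclideanSpace.norm_sq_eq,
    EuclideanSpace.norm_sq_eq]
  simp only [Fin.sum_univ_three, ← Complex.normSq_eq_norm_sq, Complex.normSq_apply,
    Real.norm_eq_abs, sq_abs]
  simp
  nlinarith [sq_nonneg (a 0 * (z 0).re + a 1 * (z 1).re + a 2 * (z 2).re),
    sq_nonneg (a 0 * (z 0).im + a 1 * (z 1).im + a 2 * (z 2).im)]

/-! ### The `L²` norm as an integral -/

theorem MeasureTheory.Lp.norm_sq_eq_integral {α F : Type*} [MeasurableSpace α] {μ : Measure α}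
    [NormedAddCommGroup F] [InnerProductSpace ℂ F] (f : Lp F 2 μ) :
    ‖f‖ ^ 2 = ∫ x, ‖f x‖ ^ 2 ∂μ := by
  have h1 := inner_self_eq_norm_sq_to_K (𝕜 := ℂ) f
  rw [L2.inner_def] at h1
  simp only [inner_self_eq_norm_sq_to_K] at h1
  have h2 : ∫ x, ((‖f x‖ : ℂ)) ^ 2 ∂μ = ((∫ x, ‖f x‖ ^ 2 ∂μ : ℝ) : ℂ) := by
    rw [← integral_complex_ofReal]; simp
  have h3 := h2.symm.trans h1
  exact (Complex.ofReal_injective (h3.trans (Complex.ofReal_pow _ _).symm)).symm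

namespace GasPlanet

variable (P : GasPlanet)

/-! ### Uniform bounds for the coefficients -/

/-- The factor `ρ₀ (g₀'·n)` of the boundary term. -/
noncomputable def boundaryWeight (x : E3) : ℝ := P.ρ x * inner ℝ (P.g x) (P.n x)

/-- Compactness turns the pointwise signs into uniform ones. On `∂M` the sign of the weight comes
from gravity pointing inward. -/
theorem exists_coefficient_bounds : ∃ m K : ℝ, 0 < m ∧ 0 < K ∧
    (∀ x ∈ P.M, m ≤ P.κ x ∧ P.κ x ≤ K ∧ m ≤ P.ρ x ∧ P.ρ x ≤ K ∧ ‖P.g x‖ ≤ K ∧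
      ‖P.gradρ x‖ ≤ K) ∧
    ∀ x ∈ frontier P.M, m ≤ -P.boundaryWeight x ∧ -P.boundaryWeight x ≤ K := by
  have hsub := P.isCompact_M.isClosed.frontier_subset
  have hM := P.isCompact_M
  obtain ⟨m1, hm1, h1⟩ := hM.exists_forall_le' P.continuous_κ (a := 0) fun x hx =>
    mul_pos (P.c_sq_pos x hx) (P.ρ_pos x hx)
  obtain ⟨m2, hm2, h2⟩ := hM.exists_forall_le' P.continuous_ρ (a := 0) P.ρ_pos
  obtain ⟨m3, hm3, h3⟩ := P.isCompact_frontier.exists_forall_le' P.continuous_weight.neg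
    (a := 0) fun x hx => neg_pos.mpr
      (mul_neg_of_pos_of_neg (P.ρ_pos x (hsub hx)) (P.g_inward x hx))
  obtain ⟨k1, e1⟩ := hM.exists_bound_of_continuousOn P.continuous_κ
  obtain ⟨k2, e2⟩ := hM.exists_bound_of_continuousOn P.continuous_ρ
  obtain ⟨k3, e3⟩ := hM.exists_bound_of_continuousOn P.continuous_g
  obtain ⟨k4, e4⟩ := hM.exists_bound_of_continuousOn P.continuous_gradρ
  obtain ⟨k5, e5⟩ := P.isCompact_frontier.exists_bound_of_continuousOn P.continuous_weight
  set K := |k1| + |k2| + |k3| + |k4| + |k5| + 1 with hK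
  have a1 := abs_nonneg k1
  have a2 := abs_nonneg k2
  have a3 := abs_nonneg k3
  have a4 := abs_nonneg k4
  have a5 := abs_nonneg k5
  refine ⟨min m1 (min m2 m3), K, lt_min hm1 (lt_min hm2 hm3), by positivity, fun x hx => ?_,
    fun x hx => ?_⟩
  · refine ⟨(min_le_left _ _).trans (h1 x hx), ?_,
      ((min_le_right _ _).trans (min_le_left _ _)).trans (h2 x hx), ?_, ?_, ?_⟩
    · linarith [le_abs_self k1, (Real.le_norm_self _).trans (e1 x hx)]
    · linarith [le_abs_self k2, (Real.le_norm_self _).trans (e2 x hx)]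
    · linarith [le_abs_self k3, e3 x hx]
    · linarith [le_abs_self k4, e4 x hx]
  · refine ⟨((min_le_right _ _).trans (min_le_right _ _)).trans (h3 x hx), ?_⟩
    have h := (neg_le_abs (P.boundaryWeight x)).trans (e5 x hx)
    linarith [le_abs_self k5]

/-! ### Integrals against the mass -/

theorem aemeasurable_ρ :
    AEMeasurable (fun x => ENNReal.ofReal (P.ρ x)) (volume.restrict P.M) :=
  (P.continuous_ρ.aestronglyMeasurable_of_isCompact P.isCompact_M
    P.isCompact_M.measurableSet).aemeasurable.ennreal_ofReal

theorem ae_toReal_ρ : ∀ᵐ x ∂(volume.restrict P.M : Measure E3),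
    (ENNReal.ofReal (P.ρ x)).toReal = P.ρ x := by
  filter_upwards [ae_restrict_mem P.isCompact_M.measurableSet] with x hx
  exact ENNReal.toReal_ofReal (P.ρ_pos x hx).le

theorem integral_mass {F : Type*} [NormedAddCommGroup F] [NormedSpace ℝ F] (h : E3 → F) :
    ∫ x, h x ∂P.mass = ∫ x in P.M, P.ρ x • h x := by
  rw [mass, integral_withDensity_eq_integral_toReal_smul₀ P.aemeasurable_ρ
    (Filter.Eventually.of_forall fun _ => ENNReal.ofReal_lt_top)]
  refine integral_congr_ae ?_
  filter_upwards [P.ae_toReal_ρ] with x hx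
  rw [hx]

variable {P}

theorem integrable_ρ_norm_sq {F : Type*} [NormedAddCommGroup F] (f : Lp F 2 P.mass) :
    Integrable (fun x => P.ρ x * ‖f x‖ ^ 2) (volume.restrict P.M) := by
  have h1 : Integrable (fun x => ‖f x‖ ^ 2) P.mass := (Lp.memLp f).integrable_norm_pow (by simp)
  refine ((integrable_withDensity_iff_integrable_smul₀' P.aemeasurable_ρ
    (Filter.Eventually.of_forall fun _ => ENNReal.ofReal_lt_top)).mp h1).congr ?_
  filter_upwards [P.ae_toReal_ρ] with x hx
  rw [hx, smul_eq_mul]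

theorem integral_ρ_norm_sq {F : Type*} [NormedAddCommGroup F] [InnerProductSpace ℂ F]
    (f : Lp F 2 P.mass) : ∫ x in P.M, P.ρ x * ‖f x‖ ^ 2 = ‖f‖ ^ 2 := by
  rw [Lp.norm_sq_eq_integral, P.integral_mass]
  rfl

theorem integrable_surface_norm_sq (f : Lp ℂ 2 P.surface) :
    Integrable (fun x => ‖f x‖ ^ 2) P.surface :=
  (Lp.memLp f).integrable_norm_pow (by simp)

theorem norm_sq_Hdiv (u : P.Hdiv) :
    ‖u‖ ^ 2 = ‖P.field u‖ ^ 2 + (‖P.divergence u‖ ^ 2 + ‖P.normalTrace u‖ ^ 2) := by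
  change ‖(u : P.Triples)‖ ^ 2 = _
  rw [WithLp.prod_norm_sq_eq_of_L2, WithLp.prod_norm_sq_eq_of_L2]
  rfl

/-- The integrand `ρ₀² |u|²` carries one factor `ρ₀` more than the norm of `H`. -/
theorem norm_massMotion_sq_le {K : ℝ} (hK : ∀ x ∈ P.M, P.ρ x ≤ K) (u : P.H) :
    ‖P.massMotion u‖ ^ 2 ≤ K * ‖u‖ ^ 2 := by
  have hmeas := P.isCompact_M.measurableSet
  have h1 : ‖P.massMotion u‖ ^ 2 = ∫ x in P.M, P.ρ x * (P.ρ x * ‖u x‖ ^ 2) := by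
    rw [Lp.norm_sq_eq_integral, ← integral_indicator hmeas]
    refine integral_congr_ae ?_
    filter_upwards [(P.memLp_massMotion u).coeFn_toLp] with x hx
    change ‖((P.memLp_massMotion u).toLp _ : Lp C3 2 (volume : Measure E3)) x‖ ^ 2 = _
    rw [hx]
    by_cases hxM : x ∈ P.M
    · simp only [Set.indicator_of_mem hxM, norm_smul, Complex.norm_real, mul_pow,
        Real.norm_eq_abs, sq_abs]
      ring
    · simp [hxM]
  rw [h1, ← integral_ρ_norm_sq u, ← integral_const_mul]
  refine integral_mono_of_nonneg ?_ ((integrable_ρ_norm_sq u).const_mul K) ?_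
  · filter_upwards [ae_restrict_mem hmeas] with x hx
    have := P.ρ_pos x hx
    simp only [Pi.zero_apply]
    positivity
  · filter_upwards [ae_restrict_mem hmeas] with x hx
    have := P.ρ_pos x hx
    exact mul_le_mul_of_nonneg_right (hK x hx) (by positivity)

/-! ### Symmetry of the energy form -/

/-- This is where `g₀' ∥ ∇ρ₀` enters: `(g₀'·v̄)(∇ρ₀·u)` is the only part of the integrand over `M`
that is not visibly Hermitian. -/
theorem dotRC_gradρ_symm {x : E3} (hx : x ∈ P.M) (y z : C3) :
    dotRC (P.g x) y * conj (dotRC (P.gradρ x) z)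
      = conj (dotRC (P.g x) z) * dotRC (P.gradρ x) y := by
  have h := P.parallel_gradρ x hx
  rw [LinearIndependent.pair_iff] at h
  push Not at h
  obtain ⟨s, t, hst, hne⟩ := h
  have hdot : ∀ (k : ℝ) (a : E3) (z : C3), dotRC (k • a) z = k * dotRC a z := by
    intro k a z
    simp [dotRC, Finset.mul_sum, mul_assoc]
  change s • P.g x + t • P.gradρ x = 0 at hst
  by_cases hs : s = 0
  · have hg : P.gradρ x = 0 := by
      rw [hs, zero_smul, zero_add] at hst
      exact (smul_eq_zero.mp hst).resolve_left (hne hs)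
    simp [hg, dotRC]
  · have hg : P.g x = (-(s⁻¹ * t)) • P.gradρ x := by
      rw [neg_smul, mul_smul, ← smul_neg, ← eq_neg_of_add_eq_zero_left hst, inv_smul_smul₀ hs]
    rw [hg, hdot, hdot, map_mul, Complex.conj_ofReal]
    ring

theorem a₂_conj_symm (v u : P.Hdiv) : conj (P.a₂ u v) = P.a₂ v u := by
  have h1 : conj (∫ x in P.M, P.bulkDensity u v x) = ∫ x in P.M, P.bulkDensity v u x := by
    rw [← integral_conj]
    refine integral_congr_ae ?_
    filter_upwards [ae_restrict_mem P.isCompact_M.measurableSet] with x hx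
    have := dotRC_gradρ_symm hx (P.field u x) (P.field v x)
    simp only [bulkDensity, map_add, map_mul, Complex.conj_ofReal, Complex.conj_conj]
    linear_combination this
  have h2 : conj (∫ x, P.boundaryDensity u v x ∂P.surface)
      = ∫ x, P.boundaryDensity v u x ∂P.surface := by
    rw [← integral_conj]
    refine integral_congr_ae (Filter.Eventually.of_forall fun x => ?_)
    simp only [boundaryDensity, map_mul, Complex.conj_ofReal, Complex.conj_conj]
    ring
  simp only [a₂, map_sub, map_mul, h1, h2, inner_conj_symm, Complex.conj_ofReal]

/-! ### Boundedness of the energy form and the Gårding inequality -/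

/-- A bound by a sum of squares integrates directly to squared norms; dividing by `m ≤ ρ₀` passes
from Lebesgue measure to the mass. -/
theorem norm_bulkDensity_le {m K : ℝ} (hm : 0 < m) (hK : 0 < K) {x : E3}
    (h : P.κ x ≤ K ∧ m ≤ P.ρ x ∧ P.ρ x ≤ K ∧ ‖P.g x‖ ≤ K ∧ ‖P.gradρ x‖ ≤ K)
    (hκ : 0 ≤ P.κ x) (v u : P.Hdiv) :
    ‖P.bulkDensity v u x‖ ≤ (K + 9 * K ^ 2) / m *
      (P.ρ x * ‖P.divergence v x‖ ^ 2 + P.ρ x * ‖P.field v x‖ ^ 2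
        + (P.ρ x * ‖P.divergence u x‖ ^ 2 + P.ρ x * ‖P.field u x‖ ^ 2)) := by
  obtain ⟨h1, h2, h3, h4, h5⟩ := h
  have hρ : 0 < P.ρ x := hm.trans_le h2
  have hdot : ∀ (a : E3) (z : C3), ‖a‖ ≤ K → ‖dotRC a z‖ ≤ 3 * K * ‖z‖ := fun a z ha =>
    (norm_dotRC_le a z).trans (by gcongr)
  have e1 := hdot _ (P.field u x) h4
  have e2 := hdot _ (P.field v x) h4
  have e3 := hdot _ (P.field u x) h5
  set dv := ‖P.divergence v x‖
  set du := ‖P.divergence u x‖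
  set fv := ‖P.field v x‖
  set fu := ‖P.field u x‖
  have hdv : 0 ≤ dv := norm_nonneg _
  have hdu : 0 ≤ du := norm_nonneg _
  have hfv : 0 ≤ fv := norm_nonneg _
  have hfu : 0 ≤ fu := norm_nonneg _
  have b1 : ‖P.bulkDensity v u x‖ ≤ K * dv * du + K * dv * (3 * K * fu)
      + 3 * K * fv * (K * du + 3 * K * fu) := by
    refine (norm_add₃_le).trans ?_
    simp only [norm_mul, Complex.norm_conj, Complex.norm_real, Real.norm_of_nonneg hρ.le,
      Real.norm_of_nonneg hκ]
    have e4 : ‖(P.ρ x : ℂ) * P.divergence u x + dotRC (P.gradρ x) (P.field u x)‖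
        ≤ K * du + 3 * K * fu := by
      refine (norm_add_le _ _).trans (add_le_add ?_ e3)
      rw [norm_mul, Complex.norm_real, Real.norm_of_nonneg hρ.le]
      gcongr
    gcongr
  have b2 : K * dv * du + K * dv * (3 * K * fu) + 3 * K * fv * (K * du + 3 * K * fu)
      ≤ (K + 9 * K ^ 2) * ((dv + fv) * (du + fu)) := by
    have : (K + 9 * K ^ 2) * ((dv + fv) * (du + fu))
        - (K * dv * du + K * dv * (3 * K * fu) + 3 * K * fv * (K * du + 3 * K * fu))
        = 9 * K ^ 2 * (dv * du) + (K + 6 * K ^ 2) * (dv * fu) + (K + 6 * K ^ 2) * (fv * du)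
          + K * (fv * fu) := by ring
    have : 0 ≤ 9 * K ^ 2 * (dv * du) + (K + 6 * K ^ 2) * (dv * fu)
      + (K + 6 * K ^ 2) * (fv * du) + K * (fv * fu) := by positivity
    linarith
  have b3 : (dv + fv) * (du + fu) ≤ dv ^ 2 + fv ^ 2 + (du ^ 2 + fu ^ 2) := by
    nlinarith [sq_nonneg (dv - du), sq_nonneg (dv - fu), sq_nonneg (fv - du),
      sq_nonneg (fv - fu)]
  have b4 : m * (dv ^ 2 + fv ^ 2 + (du ^ 2 + fu ^ 2))
      ≤ P.ρ x * dv ^ 2 + P.ρ x * fv ^ 2 + (P.ρ x * du ^ 2 + P.ρ x * fu ^ 2) := by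
    have := mul_le_mul_of_nonneg_right h2
      (by positivity : 0 ≤ dv ^ 2 + fv ^ 2 + (du ^ 2 + fu ^ 2))
    linarith
  refine b1.trans (b2.trans ?_)
  rw [div_mul_eq_mul_div, le_div_iff₀ hm, mul_assoc]
  refine mul_le_mul_of_nonneg_left ?_ (by positivity)
  linarith [mul_le_mul_of_nonneg_left b3 hm.le]

/-- Half of `κ |∇·u|²` absorbs the mixed terms by Young's inequality; the other half survives. -/
theorem re_bulkDensity_ge {m K : ℝ} (hm : 0 < m) (hK : 0 < K) {x : E3}
    (h : m ≤ P.κ x ∧ m ≤ P.ρ x ∧ P.ρ x ≤ K ∧ ‖P.g x‖ ≤ K ∧ ‖P.gradρ x‖ ≤ K) (u : P.Hdiv) :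
    m / (2 * K) * (P.ρ x * ‖P.divergence u x‖ ^ 2)
      - (18 * K ^ 4 / m + 9 * K ^ 2) / m * (P.ρ x * ‖P.field u x‖ ^ 2)
      ≤ (P.bulkDensity u u x).re := by
  obtain ⟨h1, h2, h3, h4, h5⟩ := h
  have hρ : 0 < P.ρ x := hm.trans_le h2
  have hdot : ∀ (a : E3) (z : C3), ‖a‖ ≤ K → ‖dotRC a z‖ ≤ 3 * K * ‖z‖ := fun a z ha =>
    (norm_dotRC_le a z).trans (by gcongr)
  have e1 := hdot _ (P.field u x) h4
  have e3 := hdot _ (P.field u x) h5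
  have key : P.bulkDensity u u x = ((P.κ x * ‖P.divergence u x‖ ^ 2 : ℝ) : ℂ)
      + (P.ρ x * conj (P.divergence u x) * dotRC (P.g x) (P.field u x)
      + conj (dotRC (P.g x) (P.field u x)) * (P.ρ x * P.divergence u x)
      + conj (dotRC (P.g x) (P.field u x)) * dotRC (P.gradρ x) (P.field u x)) := by
    rw [bulkDensity]
    push_cast
    rw [← Complex.conj_mul']
    ring
  set d := ‖P.divergence u x‖
  set f := ‖P.field u x‖
  have hd : 0 ≤ d := norm_nonneg _
  have hf : 0 ≤ f := norm_nonneg _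
  have b1 : ‖(P.ρ x * conj (P.divergence u x) * dotRC (P.g x) (P.field u x)
      + conj (dotRC (P.g x) (P.field u x)) * (P.ρ x * P.divergence u x)
      + conj (dotRC (P.g x) (P.field u x)) * dotRC (P.gradρ x) (P.field u x) : ℂ)‖
      ≤ K * d * (3 * K * f) + 3 * K * f * (K * d) + 3 * K * f * (3 * K * f) := by
    refine (norm_add₃_le).trans ?_
    simp only [norm_mul, Complex.norm_conj, Complex.norm_real, Real.norm_of_nonneg hρ.le]
    gcongr
  have b2 := (abs_le.mp ((Complex.abs_re_le_norm _).trans b1)).1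
  rw [key, Complex.add_re, Complex.ofReal_re]
  have c1 : m * d ^ 2 ≤ P.κ x * d ^ 2 := by gcongr
  have c2 : m / (2 * K) * (P.ρ x * d ^ 2) ≤ m / 2 * d ^ 2 := by
    have : m / (2 * K) * (P.ρ x * d ^ 2) ≤ m / (2 * K) * (K * d ^ 2) := by gcongr
    refine this.trans (le_of_eq ?_)
    field_simp
  have c3 : (18 * K ^ 4 / m + 9 * K ^ 2) * f ^ 2
      ≤ (18 * K ^ 4 / m + 9 * K ^ 2) / m * (P.ρ x * f ^ 2) := by
    rw [div_mul_eq_mul_div, le_div_iff₀ hm]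
    have : m * f ^ 2 ≤ P.ρ x * f ^ 2 := by gcongr
    have := mul_le_mul_of_nonneg_left this
      (by positivity : 0 ≤ 18 * K ^ 4 / m + 9 * K ^ 2)
    linarith
  -- Two mixed terms of size `3K² d f` each; `18 K⁴ / m` is what completes the square.
  have c4 : 6 * K ^ 2 * d * f ≤ m / 2 * d ^ 2 + 18 * K ^ 4 / m * f ^ 2 := by
    have : m / 2 * d ^ 2 + 18 * K ^ 4 / m * f ^ 2 - 6 * K ^ 2 * d * f
        = m / 2 * (d - 6 * K ^ 2 / m * f) ^ 2 := by field_simp; ring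
    have : 0 ≤ m / 2 * (d - 6 * K ^ 2 / m * f) ^ 2 := by positivity
    linarith
  linarith

theorem norm_boundaryDensity_le {K : ℝ} {x : E3} (h0 : 0 ≤ -P.boundaryWeight x)
    (hK : -P.boundaryWeight x ≤ K) (v u : P.Hdiv) :
    ‖P.boundaryDensity v u x‖ ≤ K * (‖P.normalTrace v x‖ ^ 2 + ‖P.normalTrace u x‖ ^ 2) := by
  have hw : ‖((P.boundaryWeight x : ℝ) : ℂ)‖ ≤ K := by
    rw [Complex.norm_real, Real.norm_of_nonpos (by linarith)]; exact hK
  change ‖conj (P.normalTrace v x) * (((P.boundaryWeight x : ℝ) : ℂ) * P.normalTrace u x)‖ ≤ _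
  rw [norm_mul, norm_mul, Complex.norm_conj]
  set a := ‖P.normalTrace v x‖
  set b := ‖P.normalTrace u x‖
  have hb : 0 ≤ b := norm_nonneg _
  have ha : 0 ≤ a := norm_nonneg _
  calc a * (‖((P.boundaryWeight x : ℝ) : ℂ)‖ * b) ≤ a * (K * b) := by gcongr
    _ = K * (a * b) := by ring
    _ ≤ K * (a ^ 2 + b ^ 2) := by
      refine mul_le_mul_of_nonneg_left ?_ (h0.trans hK)
      nlinarith [sq_nonneg (a - b)]

theorem boundaryDensity_self_re (u : P.Hdiv) (x : E3) :
    (P.boundaryDensity u u x).re = P.boundaryWeight x * ‖P.normalTrace u x‖ ^ 2 := by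
  have : P.boundaryDensity u u x
      = ((P.boundaryWeight x * ‖P.normalTrace u x‖ ^ 2 : ℝ) : ℂ) := by
    push_cast
    rw [← Complex.conj_mul', boundaryDensity, boundaryWeight]
    ring
  rw [this, Complex.ofReal_re]

theorem norm_gravityGradient_massMotion_sq_le {K : ℝ} (hK : ∀ x ∈ P.M, P.ρ x ≤ K) (u : P.H) :
    ‖gravityGradient P.G (P.massMotion u)‖ ^ 2 ≤ ‖gravityGradient P.G‖ ^ 2 * K * ‖u‖ ^ 2 := by
  have h1 := pow_le_pow_left₀ (norm_nonneg _)
    ((gravityGradient P.G).le_opNorm (P.massMotion u)) 2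
  rw [mul_pow] at h1
  have h2 := mul_le_mul_of_nonneg_left (norm_massMotion_sq_le hK u)
    (sq_nonneg ‖gravityGradient P.G‖)
  linarith

variable (P)

theorem exists_norm_a₂_le_add_sq :
    ∃ K : ℝ, 0 ≤ K ∧ ∀ v u : P.Hdiv, ‖P.a₂ v u‖ ≤ K * (‖v‖ ^ 2 + ‖u‖ ^ 2) := by
  obtain ⟨m, K, hm, hK, hM, hF⟩ := P.exists_coefficient_bounds
  have hG : 0 < 1 / (4 * Real.pi * P.G) := by have := P.G_pos; positivity
  set A := (K + 9 * K ^ 2) / m with hA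
  set B := 1 / (4 * Real.pi * P.G) * (‖gravityGradient P.G‖ ^ 2 * K) with hB
  have hA0 : 0 ≤ A := by positivity
  have hB0 : 0 ≤ B := by positivity
  refine ⟨A + B + K, by positivity, fun v u => ?_⟩
  have i1 := integrable_ρ_norm_sq (P.divergence v)
  have i2 := integrable_ρ_norm_sq (P.field v)
  have i3 := integrable_ρ_norm_sq (P.divergence u)
  have i4 := integrable_ρ_norm_sq (P.field u)
  have b1 : ‖∫ x in P.M, P.bulkDensity v u x‖ ≤ A * (‖P.divergence v‖ ^ 2 + ‖P.field v‖ ^ 2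
      + (‖P.divergence u‖ ^ 2 + ‖P.field u‖ ^ 2)) := by
    refine (norm_integral_le_of_norm_le (((i1.add i2).add (i3.add i4)).const_mul A)
      ?_).trans (le_of_eq ?_)
    · filter_upwards [ae_restrict_mem P.isCompact_M.measurableSet] with x hx
      obtain ⟨h1, h2⟩ := hM x hx
      exact norm_bulkDensity_le hm hK h2 (hm.le.trans h1) v u
    · rw [integral_const_mul, integral_add' (i1.add i2) (i3.add i4), integral_add' i1 i2,
        integral_add' i3 i4]
      simp only [integral_ρ_norm_sq]
  have b2 : ‖∫ x, P.boundaryDensity v u x ∂P.surface‖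
      ≤ K * (‖P.normalTrace v‖ ^ 2 + ‖P.normalTrace u‖ ^ 2) := by
    have j1 := integrable_surface_norm_sq (P.normalTrace v)
    have j2 := integrable_surface_norm_sq (P.normalTrace u)
    refine (norm_integral_le_of_norm_le ((j1.add j2).const_mul K) ?_).trans (le_of_eq ?_)
    · filter_upwards [ae_restrict_mem isClosed_frontier.measurableSet] with x hx
      obtain ⟨h1, h2⟩ := hF x hx
      exact norm_boundaryDensity_le (hm.le.trans h1) h2 v u
    · rw [integral_const_mul, Lp.norm_sq_eq_integral, Lp.norm_sq_eq_integral,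
        ← integral_add j1 j2]
      rfl
  have b3 : ‖((1 / (4 * Real.pi * P.G) : ℝ) : ℂ)
        * inner ℂ (gravityGradient P.G (P.massMotion (P.field v)))
            (gravityGradient P.G (P.massMotion (P.field u)))‖
      ≤ B * (‖P.field v‖ ^ 2 + ‖P.field u‖ ^ 2) := by
    rw [norm_mul, Complex.norm_real, Real.norm_of_nonneg hG.le, hB, mul_assoc (1 / (4 * Real.pi * P.G))]
    refine mul_le_mul_of_nonneg_left ?_ hG.le
    refine (norm_inner_le_norm _ _).trans ?_
    have e1 := norm_gravityGradient_massMotion_sq_le (fun x hx => (hM x hx).2.2.2.1) (P.field v)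
    have e2 := norm_gravityGradient_massMotion_sq_le (fun x hx => (hM x hx).2.2.2.1) (P.field u)
    nlinarith [sq_nonneg (‖gravityGradient P.G (P.massMotion (P.field v))‖
      - ‖gravityGradient P.G (P.massMotion (P.field u))‖)]
  have hv := norm_sq_Hdiv v
  have hu := norm_sq_Hdiv u
  have f1 : ‖P.divergence v‖ ^ 2 + ‖P.field v‖ ^ 2 + (‖P.divergence u‖ ^ 2 + ‖P.field u‖ ^ 2)
      ≤ ‖v‖ ^ 2 + ‖u‖ ^ 2 := by
    rw [hv, hu]; linarith [sq_nonneg ‖P.normalTrace v‖, sq_nonneg ‖P.normalTrace u‖]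
  have f2 : ‖P.normalTrace v‖ ^ 2 + ‖P.normalTrace u‖ ^ 2 ≤ ‖v‖ ^ 2 + ‖u‖ ^ 2 := by
    rw [hv, hu]
    linarith [sq_nonneg ‖P.field v‖, sq_nonneg ‖P.field u‖, sq_nonneg ‖P.divergence v‖,
      sq_nonneg ‖P.divergence u‖]
  have f3 : ‖P.field v‖ ^ 2 + ‖P.field u‖ ^ 2 ≤ ‖v‖ ^ 2 + ‖u‖ ^ 2 := by
    rw [hv, hu]
    linarith [sq_nonneg ‖P.normalTrace v‖, sq_nonneg ‖P.normalTrace u‖,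
      sq_nonneg ‖P.divergence v‖, sq_nonneg ‖P.divergence u‖]
  have g1 := b1.trans (mul_le_mul_of_nonneg_left f1 hA0)
  have g2 := b2.trans (mul_le_mul_of_nonneg_left f2 hK.le)
  have g3 := b3.trans (mul_le_mul_of_nonneg_left f3 hB0)
  rw [a₂]
  refine (norm_sub_le _ _).trans ?_
  have := norm_sub_le (∫ x in P.M, P.bulkDensity v u x) (((1 / (4 * Real.pi * P.G) : ℝ) : ℂ)
        * inner ℂ (gravityGradient P.G (P.massMotion (P.field v)))
            (gravityGradient P.G (P.massMotion (P.field u))))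
  linarith

/-- The Gårding inequality for the energy form. -/
theorem exists_garding : ∃ c C : ℝ, 0 < c ∧ 0 ≤ C ∧
    ∀ u : P.Hdiv, c * ‖u‖ ^ 2 - C * ‖P.field u‖ ^ 2 ≤ (P.a₂ u u).re := by
  obtain ⟨m, K, hm, hK, hM, hF⟩ := P.exists_coefficient_bounds
  have hG : 0 < 1 / (4 * Real.pi * P.G) := by have := P.G_pos; positivity
  set A := (18 * K ^ 4 / m + 9 * K ^ 2) / m with hA
  set B := 1 / (4 * Real.pi * P.G) * (‖gravityGradient P.G‖ ^ 2 * K) with hB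
  set c := min (m / (2 * K)) m with hc
  have hA0 : 0 ≤ A := by positivity
  have hB0 : 0 ≤ B := by positivity
  have hc0 : 0 < c := lt_min (by positivity) hm
  -- `A` pays for the bulk terms, `B` for gravity, and the last `c` for the `H` part of `‖u‖²`.
  refine ⟨c, A + B + c, hc0, by positivity, fun u => ?_⟩
  have b1 : m / (2 * K) * ‖P.divergence u‖ ^ 2 - A * ‖P.field u‖ ^ 2
      ≤ (∫ x in P.M, P.bulkDensity u u x).re := by
    have e1 : (∫ x in P.M, P.bulkDensity u u x).re = ∫ x in P.M, (P.bulkDensity u u x).re :=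
      (integral_re (P.integrable_bulkDensity u u)).symm
    have i1 := (integrable_ρ_norm_sq (P.divergence u)).const_mul (m / (2 * K))
    have i2 := (integrable_ρ_norm_sq (P.field u)).const_mul A
    rw [e1, ← integral_ρ_norm_sq (P.divergence u), ← integral_ρ_norm_sq (P.field u),
      ← integral_const_mul, ← integral_const_mul, ← integral_sub i1 i2]
    refine integral_mono_ae (i1.sub i2) (P.integrable_bulkDensity u u).re ?_
    filter_upwards [ae_restrict_mem P.isCompact_M.measurableSet] with x hx
    obtain ⟨h1, -, h2⟩ := hM x hx
    exact re_bulkDensity_ge hm hK ⟨h1, h2⟩ u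
  -- This integral is subtracted in `a₂`, so its negativity yields control of the normal trace.
  have b2 : (∫ x, P.boundaryDensity u u x ∂P.surface).re ≤ -(m * ‖P.normalTrace u‖ ^ 2) := by
    have e1 : (∫ x, P.boundaryDensity u u x ∂P.surface).re
        = ∫ x, (P.boundaryDensity u u x).re ∂P.surface :=
      (integral_re (P.integrable_boundaryDensity u u)).symm
    have j1 := ((integrable_surface_norm_sq (P.normalTrace u)).const_mul m).neg
    rw [e1, Lp.norm_sq_eq_integral, ← integral_const_mul, ← integral_neg]
    refine integral_mono_ae (P.integrable_boundaryDensity u u).re j1 ?_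
    filter_upwards [ae_restrict_mem isClosed_frontier.measurableSet] with x hx
    have h1 := (hF x hx).1
    change (P.boundaryDensity u u x).re ≤ -(m * ‖P.normalTrace u x‖ ^ 2)
    rw [boundaryDensity_self_re]
    nlinarith [sq_nonneg ‖P.normalTrace u x‖]
  have b3 : (((1 / (4 * Real.pi * P.G) : ℝ) : ℂ)
        * inner ℂ (gravityGradient P.G (P.massMotion (P.field u)))
            (gravityGradient P.G (P.massMotion (P.field u)))).re ≤ B * ‖P.field u‖ ^ 2 := by
    rw [Complex.re_ofReal_mul, hB, mul_assoc (1 / (4 * Real.pi * P.G))]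
    refine mul_le_mul_of_nonneg_left ?_ hG.le
    have e1 := norm_gravityGradient_massMotion_sq_le (fun x hx => (hM x hx).2.2.2.1) (P.field u)
    exact (le_of_eq (inner_self_eq_norm_sq (𝕜 := ℂ) _)).trans e1
  rw [a₂, Complex.sub_re, Complex.sub_re, norm_sq_Hdiv]
  have d1 : c * ‖P.divergence u‖ ^ 2 ≤ m / (2 * K) * ‖P.divergence u‖ ^ 2 :=
    mul_le_mul_of_nonneg_right (min_le_left _ _) (sq_nonneg _)
  have d2 : c * ‖P.normalTrace u‖ ^ 2 ≤ m * ‖P.normalTrace u‖ ^ 2 :=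
    mul_le_mul_of_nonneg_right (min_le_right _ _) (sq_nonneg _)
  linarith

end GasPlanet

namespace GasPlanet

variable (P : GasPlanet)

/-! ### The operator representing the energy form -/

instance : CompleteSpace P.Hdiv :=
  inferInstanceAs (CompleteSpace P.smoothTriples.topologicalClosure)

theorem norm_field_le (u : P.Hdiv) : ‖P.field u‖ ≤ ‖u‖ := by
  refine (sq_le_sq₀ (norm_nonneg _) (norm_nonneg _)).mp ?_
  rw [norm_sq_Hdiv]
  linarith [sq_nonneg ‖P.divergence u‖, sq_nonneg ‖P.normalTrace u‖]

theorem isBoundedLinearMap_field : IsBoundedLinearMap ℂ P.field :=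
  IsLinearMap.with_bound ⟨fun _ _ => rfl, fun _ _ => rfl⟩ 1 fun u => by
    rw [one_mul]; exact P.norm_field_le u

theorem a₂_add_left (v v' u : P.Hdiv) : P.a₂ (v + v') u = P.a₂ v u + P.a₂ v' u := by
  rw [← a₂_conj_symm, a₂_add_right, map_add, a₂_conj_symm, a₂_conj_symm]

theorem a₂_smul_left (k : ℂ) (v u : P.Hdiv) : P.a₂ (k • v) u = conj k * P.a₂ v u := by
  rw [← a₂_conj_symm, a₂_smul_right, map_mul, a₂_conj_symm]

/-- By homogeneity: the bound by a sum of squares, applied to unit vectors, gives `2K`. -/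
theorem exists_norm_a₂_le_mul :
    ∃ K : ℝ, ∀ v u : P.Hdiv, ‖P.a₂ v u‖ ≤ K * ‖v‖ * ‖u‖ := by
  obtain ⟨K, -, hK⟩ := P.exists_norm_a₂_le_add_sq
  refine ⟨2 * K, fun v u => ?_⟩
  rcases eq_or_ne v 0 with rfl | hv
  · have := P.a₂_smul_left 0 0 u
    rw [zero_smul, map_zero, zero_mul] at this
    simp [this]
  rcases eq_or_ne u 0 with rfl | hu
  · have := P.a₂_smul_right 0 v 0
    rw [zero_smul, zero_mul] at this
    simp [this]
  have hv' := norm_pos_iff.mpr hv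
  have hu' := norm_pos_iff.mpr hu
  have h := hK (((‖v‖⁻¹ : ℝ) : ℂ) • v) (((‖u‖⁻¹ : ℝ) : ℂ) • u)
  rw [a₂_smul_left, a₂_smul_right, norm_mul, norm_mul, norm_smul, norm_smul, Complex.norm_conj,
    Complex.norm_real, Complex.norm_real, norm_inv, norm_inv, norm_norm, norm_norm,
    inv_mul_cancel₀ hv'.ne', inv_mul_cancel₀ hu'.ne'] at h
  have h2 : ‖P.a₂ v u‖ = ‖v‖ * ‖u‖ * (‖v‖⁻¹ * (‖u‖⁻¹ * ‖P.a₂ v u‖)) := by field_simp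
  rw [h2]
  have := mul_le_mul_of_nonneg_left h (mul_nonneg hv'.le hu'.le)
  linarith

theorem isBoundedForm_a₂ : IsBoundedForm P.a₂ :=
  ⟨P.a₂_add_left, P.a₂_smul_left, P.a₂_add_right, P.a₂_smul_right, P.exists_norm_a₂_le_mul⟩

/-! ### The operator `A₂` -/

instance : IsFiniteMeasure P.mass :=
  isFiniteMeasure_withDensity_ofReal
    (P.continuous_ρ.integrableOn_compact P.isCompact_M).hasFiniteIntegral

/-- Test fields of the interior of `M` belong to `H_Div(M, L²(∂M))`. -/
theorem exists_field_ae_eq {U : E3 → C3} (hU : ContDiff ℝ ∞ U) (hc : HasCompactSupport U)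
    (h0 : ∀ x, x ∉ interior P.M → U x = 0) : ∃ v : P.Hdiv, P.field v =ᵐ[P.mass] U := by
  have hU2 : MemLp U 2 P.mass := hU.continuous.memLp_of_hasCompactSupport hc
  have hdc : Continuous (div3 U) := by
    have := hU.continuous_fderiv (by simp)
    unfold div3
    fun_prop
  have hds : HasCompactSupport (div3 U) :=
    (hc.fderiv (𝕜 := ℝ)).comp_left
      (g := fun A : E3 →L[ℝ] C3 => ∑ i, (A (EuclideanSpace.single i 1)) i) (by simp)
  have hd2 : MemLp (div3 U) 2 P.mass := hdc.memLp_of_hasCompactSupport hds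
  refine ⟨⟨WithLp.toLp 2 (hU2.toLp U, WithLp.toLp 2 (hd2.toLp (div3 U), 0)),
    Submodule.le_topologicalClosure _ ⟨U, hU, hU2.coeFn_toLp, hd2.coeFn_toLp, ?_⟩⟩,
    hU2.coeFn_toLp⟩
  filter_upwards [Lp.coeFn_zero ℂ 2 P.surface,
    ae_restrict_mem isClosed_frontier.measurableSet] with x hx hxf
  refine hx.trans ?_
  rw [h0 x hxf.2]
  simp [dotRC]

/-- The range of `H_Div(M, L²(∂M))` in `H` contains the test fields of the interior of `M`, and
hence is dense. -/
theorem eq_zero_of_forall_inner_field {f : P.H} (hf : ∀ v : P.Hdiv, inner ℂ (P.field v) f = 0) :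
    f = 0 := by
  have hmeas := P.isCompact_M.measurableSet
  -- The fundamental lemma of the calculus of variations, one component at a time, with test fields
  -- `φ eᵢ`.
  have hcomp : ∀ i : Fin 3, ∀ᵐ x, x ∈ interior P.M → (P.ρ x : ℂ) * f x i = 0 := by
    intro i
    have hf1 : MemLp (fun x => (P.ρ x : ℂ) • f x) 2 (volume.restrict P.M) :=
      memLp_weight P.isCompact_M P.continuous_ρ (P.memLp_of_mass (Lp.memLp f))
    have hf2 : MemLp (fun x => (P.ρ x : ℂ) * f x i) 2 (volume.restrict P.M) :=
      (hf1.continuousLinearMap_comp (EuclideanSpace.proj (𝕜 := ℂ) i) :)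
    have : IsFiniteMeasure (volume.restrict P.M : Measure E3) :=
      ⟨by rw [Measure.restrict_apply_univ]; exact P.isCompact_M.measure_lt_top⟩
    have hint : IntegrableOn (fun x => (P.ρ x : ℂ) * f x i) P.M := hf2.integrable (by simp)
    refine isOpen_interior.ae_eq_zero_of_integral_contDiff_smul_eq_zero
      (hint.mono_set interior_subset).locallyIntegrableOn fun φ hφ hφc hφs => ?_
    have hφ0 : ∀ x, x ∉ interior P.M → φ x = 0 := fun x hx =>
      image_eq_zero_of_notMem_tsupport fun h => hx (hφs h)
    obtain ⟨v, hv⟩ := P.exists_field_ae_eq (U := fun x => φ x • EuclideanSpace.single i (1 : ℂ))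
      (hφ.smul contDiff_const) hφc.smul_right fun x hx => by simp [hφ0 x hx]
    have h1 := hf v
    rw [L2.inner_def, P.integral_mass] at h1
    rw [← setIntegral_eq_integral_of_forall_compl_eq_zero (s := P.M)
      fun x hx => by rw [hφ0 x fun h => hx (interior_subset h), zero_smul], ← h1]
    refine integral_congr_ae ?_
    filter_upwards [P.ae_of_mass hv] with x hx
    rw [hx, PiLp.inner_apply]
    simp [apply_ite (starRingEnd ℂ)]
    ring
  have hall : ∀ᵐ x, x ∈ P.M → f x = 0 := by
    filter_upwards [ae_all_iff.mpr hcomp,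
      measure_eq_zero_iff_ae_notMem.mp P.domain_M.volume_frontier] with x hx hxf hxM
    have hxi : x ∈ interior P.M := by
      by_contra h
      exact hxf ⟨subset_closure hxM, h⟩
    ext i
    exact (mul_eq_zero.mp (hx i hxi)).resolve_left
      (Complex.ofReal_ne_zero.mpr (P.ρ_pos x hxM).ne')
  refine (Lp.eq_zero_iff_ae_eq_zero).mpr ?_
  exact (withDensity_absolutelyContinuous _ _).ae_le ((ae_restrict_iff' hmeas).mpr hall)

variable {P}

/-- Single-valuedness of `A₂`. If the field of `u` vanishes, then `a₂(u, u) = ⟨0, f⟩ = 0`, and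
Gårding forces `u = 0` as a triple; density then gives `f = 0`. Injectivity of `field` on all of
`H_Div` is not needed. -/
theorem snd_eq_zero_of_mem_A₂graph (p : P.H × P.H) (hp : p ∈ P.A₂graph) (h0 : p.1 = 0) :
    p.2 = 0 := by
  obtain ⟨u, hu, hv⟩ := hp
  obtain ⟨c, C, hc, -, hG⟩ := P.exists_garding
  rw [h0] at hu
  have h1 := hG u
  rw [hv, hu, inner_zero_left, norm_zero, Complex.zero_re] at h1
  have hu0 : u = 0 := by
    by_contra h
    have := norm_pos_iff.mpr h
    have : 0 < c * ‖u‖ ^ 2 := by positivity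
    linarith
  refine P.eq_zero_of_forall_inner_field fun v => ?_
  rw [← hv, hu0]
  have := P.a₂_smul_right 0 v 0
  rwa [zero_smul, zero_mul] at this

theorem exists_of_mem_domain (u : P.A₂.domain) :
    ∃ w : P.Hdiv, P.field w = u ∧ ∀ v, P.a₂ v w = inner ℂ (P.field v) (P.A₂ u) :=
  Submodule.mem_graph_toLinearPMap snd_eq_zero_of_mem_A₂graph u

theorem exists_A₂_eq {w : P.Hdiv} {f : P.H} (h : ∀ v, P.a₂ v w = inner ℂ (P.field v) f) :
    ∃ hw : P.field w ∈ P.A₂.domain, P.A₂ ⟨P.field w, hw⟩ = f := by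
  have hmem : (P.field w, f) ∈ P.A₂graph := ⟨w, rfl, h⟩
  have hgr : (P.field w, f) ∈ P.A₂.graph := by
    rw [A₂, Submodule.toLinearPMap_graph_eq _ snd_eq_zero_of_mem_A₂graph]; exact hmem
  obtain ⟨y, hy1, hy2⟩ := LinearPMap.mem_graph_iff _ |>.mp hgr
  simp only at hy1 hy2
  exact ⟨hy1 ▸ y.2, by rw [← hy2]; congr 1; exact Subtype.ext hy1.symm⟩

/-- A lower bound of `A₂` is a lower bound of its form. -/
theorem lowerBound_form {γ : ℝ} (hγ : IsOperatorLowerBound P.A₂ γ) (w : P.Hdiv) :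
    γ * ‖P.field w‖ ^ 2 ≤ (P.a₂ w w).re := by
  obtain ⟨c, C, hc, -, hG⟩ := P.exists_garding
  refine P.isBoundedForm_a₂.lowerBound_of_operator_lowerBound P.isBoundedLinearMap_field
    (fun u v => a₂_conj_symm v u) hc hG (fun u f hu => ?_) w
  obtain ⟨hw, hA⟩ := exists_A₂_eq hu
  have := hγ ⟨P.field u, hw⟩
  rwa [hA] at this

variable (P)

theorem exists_operatorLowerBound : ∃ γ : ℝ, IsOperatorLowerBound P.A₂ γ := by
  obtain ⟨c, C, hc, -, hG⟩ := P.exists_garding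
  refine ⟨-C, fun u => ?_⟩
  obtain ⟨w, hw, h⟩ := exists_of_mem_domain u
  have h1 := hG w
  rw [h w, hw] at h1
  have : 0 ≤ c * ‖w‖ ^ 2 := by positivity
  linarith

/-! ### The Coriolis term -/

theorem inner_R_re (u : P.H) : (inner ℂ u (P.R u) : ℂ).re = 0 := by
  have h1 : (∫ x, (inner ℂ (u x) (P.R u x) : ℂ) ∂P.mass).re
      = ∫ x, (inner ℂ (u x) (P.R u x) : ℂ).re ∂P.mass :=
    (integral_re (L2.integrable_inner (𝕜 := ℂ) u (P.R u))).symm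
  rw [L2.inner_def, h1]
  refine integral_eq_zero_of_ae ?_
  filter_upwards [(crossRC P.Ω).coeFn_compLpL (p := 2) (μ := P.mass) u] with x hx
  change P.R u x = _ at hx
  rw [hx]
  exact inner_crossRC_re _ _

theorem norm_R_le (u : P.H) : ‖P.R u‖ ≤ ‖P.Ω‖ * ‖u‖ := by
  refine Lp.norm_le_mul_norm_of_ae_le_mul ?_
  filter_upwards [(crossRC P.Ω).coeFn_compLpL (p := 2) (μ := P.mass) u] with x hx
  change P.R u x = _ at hx
  rw [hx]
  exact norm_crossRC_le _ _

/-! ### The quadratic pencil -/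

/-- The form `a₂(v, u) + z² ⟨v, u⟩ + 2 z ⟨v, Ω × u⟩` associated with `L(z)`. -/
noncomputable def pencilForm (z : ℂ) (v u : P.Hdiv) : ℂ :=
  P.a₂ v u + inner ℂ (P.field v) ((z ^ 2 • ContinuousLinearMap.id ℂ P.H
    + (2 * z) • P.R) (P.field u))

variable {P}

theorem pencilForm_eq (z : ℂ) (v u : P.Hdiv) : P.pencilForm z v u = P.a₂ v u
    + inner ℂ (P.field v) (z ^ 2 • P.field u + (2 * z) • P.R (P.field u)) := rfl

/-- Reduces the pencil to a scalar quadratic: symmetry of `a₂` makes its constant term real, and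
skew-adjointness of `R_Ω` makes the Coriolis term purely imaginary. -/
theorem pencilForm_self (z : ℂ) (u : P.Hdiv) : ∃ β : ℝ, |β| ≤ ‖P.Ω‖ * ‖P.field u‖ ^ 2 ∧
    P.pencilForm z u u = z ^ 2 * ((‖P.field u‖ ^ 2 : ℝ) : ℂ) + 2 * z * (β * Complex.I)
      + ((P.a₂ u u).re : ℂ) := by
  refine ⟨(inner ℂ (P.field u) (P.R (P.field u)) : ℂ).im, ?_, ?_⟩
  · refine (Complex.abs_im_le_norm _).trans ((norm_inner_le_norm _ _).trans ?_)
    have := mul_le_mul_of_nonneg_left (P.norm_R_le (P.field u)) (norm_nonneg (P.field u))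
    linarith
  · have h1 : P.a₂ u u = ((P.a₂ u u).re : ℂ) :=
      (Complex.conj_eq_iff_re.mp (a₂_conj_symm u u)).symm
    have h2 : (inner ℂ (P.field u) (P.R (P.field u)) : ℂ)
        = (inner ℂ (P.field u) (P.R (P.field u)) : ℂ).im * Complex.I := by
      conv_lhs => rw [← Complex.re_add_im (inner ℂ (P.field u) (P.R (P.field u)))]
      rw [inner_R_re]; simp
    have h3 : (inner ℂ (P.field u) (P.field u) : ℂ) = ((‖P.field u‖ ^ 2 : ℝ) : ℂ) := by
      rw [inner_self_eq_norm_sq_to_K]; push_cast; rfl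
    rw [pencilForm_eq, inner_add_right, inner_smul_right, inner_smul_right, h3, ← h2, ← h1]
    ring

/-- If the form associated with `L(z)` is coercive, then `z` is in the resolvent set. -/
theorem mem_resolventSet_of_coercive {z : ℂ} {k : ℝ} (hk : 0 < k)
    (h : ∀ u, k * ‖u‖ ^ 2 ≤ ‖P.pencilForm z u u‖) : z ∈ pencilResolventSet P.L := by
  have hL : ∀ u : (P.L z).domain, P.L z u
      = (z ^ 2 • (u : P.H) + (2 * z) • P.R u) + P.A₂ ⟨u, u.2⟩ := fun u => rfl
  have hbound : ∀ u : (P.L z).domain, k * ‖(u : P.H)‖ ≤ ‖P.L z u‖ := by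
    intro u
    obtain ⟨w, hw, hw'⟩ := exists_of_mem_domain (P := P) ⟨u, u.2⟩
    simp only at hw
    have h1 : P.pencilForm z w w = inner ℂ (u : P.H) (P.L z u) := by
      rw [pencilForm_eq, hw', hw, hL, inner_add_right _ _ (P.A₂ _), add_comm]
    have h2 := h w
    rw [h1] at h2
    have h3 : ‖(u : P.H)‖ ≤ ‖w‖ := hw ▸ P.norm_field_le w
    have h4 := h2.trans (norm_inner_le_norm _ _)
    have h5 : k * ‖(u : P.H)‖ ^ 2 ≤ ‖(u : P.H)‖ * ‖P.L z u‖ :=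
      le_trans (by gcongr) h4
    rcases (norm_nonneg (u : P.H)).eq_or_lt with h0 | h0
    · rw [← h0, mul_zero]; exact norm_nonneg _
    · refine le_of_mul_le_mul_left ?_ h0
      linarith
  refine ⟨⟨fun u u' huu => ?_, fun f => ?_⟩, k⁻¹, fun u => ?_⟩
  · have h1 := hbound (u - u')
    have h2 : P.L z (u - u') = 0 := by
      rw [LinearPMap.map_sub]; exact sub_eq_zero.mpr huu
    rw [h2, norm_zero] at h1
    have h3 : ‖((u - u' : (P.L z).domain) : P.H)‖ = 0 :=
      le_antisymm (nonpos_of_mul_nonpos_right h1 hk) (norm_nonneg _)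
    exact sub_eq_zero.mp (Subtype.ext (norm_eq_zero.mp h3))
  -- The weak solution lies in `D(A₂)`: moving the bounded terms to the right-hand side represents
  -- `a₂(·, w)` by an element of `H`.
  · obtain ⟨w, hw⟩ := (P.isBoundedForm_a₂.add_inner P.isBoundedLinearMap_field
      (z ^ 2 • ContinuousLinearMap.id ℂ P.H + (2 * z) • P.R)).exists_forall_eq_of_coercive hk h
        P.isBoundedLinearMap_field f
    obtain ⟨hmem, hA⟩ := exists_A₂_eq (w := w)
      (f := f - (z ^ 2 • P.field w + (2 * z) • P.R (P.field w))) fun v => by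
        rw [inner_sub_right, ← hw v]
        exact (add_sub_cancel_right _ _).symm
    refine ⟨⟨P.field w, hmem⟩, ?_⟩
    simp only
    rw [hL, hA]
    simp
  · rw [inv_mul_eq_div, le_div_iff₀ hk, mul_comm]
    exact hbound u

end GasPlanet

/-! ### The two spectral enclosures -/

theorem proposition6p1 (P : GasPlanet) :
    pencilSpectrum P.L ⊆ {z : ℂ | z.re = 0} ∪ {z : ℂ | |z.im| ≤ ‖P.Ω‖} ∧
    (∃ γ : ℝ, IsOperatorLowerBound P.A₂ γ) ∧
    ∀ γ : ℝ, IsOperatorLowerBound P.A₂ γ →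
      ∀ z ∈ pencilSpectrum P.L, z.re ≠ 0 → ‖z‖ ^ 2 ≤ max 0 (-γ) := by
  obtain ⟨c, C, hc, hC, hG⟩ := P.exists_garding
  refine ⟨fun z hz => ?_, P.exists_operatorLowerBound, fun γ hγ z hz hx => ?_⟩
  · by_contra hcon
    simp only [Set.mem_union, Set.mem_ofPred_eq, not_or, not_le] at hcon
    obtain ⟨k, hk, hq⟩ := quadratic_coercive_of_abs_im_gt hcon.1 (norm_nonneg P.Ω) hcon.2 hc hC
    refine hz (GasPlanet.mem_resolventSet_of_coercive hk fun u => ?_)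
    obtain ⟨β, hβ, hform⟩ := GasPlanet.pencilForm_self z u
    rw [hform]
    exact hq _ _ _ β (sq_nonneg _) hβ (hG u)
  · by_contra! hcon
    -- For `γ ≥ 0` the condition `-γ < |z|²` holds for every `z` off the imaginary axis, so the
    -- value `0` of the maximum means that no such spectrum exists.
    obtain ⟨k, hk, hq⟩ := quadratic_coercive_of_lowerBound hx
      ((le_max_right 0 (-γ)).trans_lt hcon) hc hC
    refine hz (GasPlanet.mem_resolventSet_of_coercive hk fun u => ?_)
    obtain ⟨β, -, hform⟩ := GasPlanet.pencilForm_self z u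
    rw [hform]
    exact hq _ _ _ β (sq_nonneg _) (sq_nonneg _) (GasPlanet.lowerBound_form hγ u) (hG u)
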